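/- Let $d\ge 1$. For each $j=1,\dots,d$ let $(a_j,b_j)$ be an open interval with $-\infty\le a_j\le 0$ and $1\le b_j\le\infty$, and let $p_j,q_j$ be positive continuous functions on $(a_j,b_j)$ with $p_j/q_j$ strictly increasing. Put $$k_j(x,x')=p_j(x\wedge x')\,q_j(x\vee x'),\qquad k(\mathbf x,\mathbf x')=\prod_{j=1}^d k_j(x_j,x_j'),$$ the latter being a kernel on $\prod_{j=1}^d(a_j,b_j)$. For a kernel $\kappa$ on a set $I$ and $X_0\subseteq I$, let $\mathscr H_\kappa(X_0)$ denote the space of restrictions to $X_0$ of the functions in the reproducing kernel Hilbert space $\mathscr H_\kappa$ of $\kappa$, with norm $\|g\|_{\mathscr H_\kappa(X_0)}=\inf\{\|h\|_{\mathscr H_\kappa}: h\in\mathscr H_\kappa,\ h|_{X_0}=g\}$. Assume that for each $j$ there are constants $c_j,\tilde c_j>0$ such that * every $g\in\mathscr H_{k_j}((0,1))$ is square integrable with a square integrable weak derivative $g'$, and $c_j\int_0^1|g'|^2\,dx\le\|g\|_{\mathscr H_{k_j}((0,1))}^2$; * every continuous $g\in L^2(0,1)$ with weak derivative $g'\in L^2(0,1)$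 lies in $\mathscr H_{k_j}((0,1))$, and $\|g\|_{\mathscr H_{k_j}((0,1))}^2\le\tilde c_j\int_0^1\bigl(|g|^2+|g'|^2\bigr)\,dx$. (Brownian field kernels $\prod_{j}[\theta_j+\gamma_j(x_j\wedge x_j')]$ with $\theta_j,\gamma_j>0$, and Laplace kernels, are examples.) For integers $\tau\ge1$ let $\mathcal X_\tau^{\mathsf{SG}}\subset(0,1)^d$ be the classical sparse grid $$\mathcal X_\tau^{\mathsf{SG}}=\bigcup_{\substack{l_1,\dots,l_d\ge 1\\ l_1+\cdots+l_d\le\tau+d-1}}\ \prod_{j=1}^d\bigl\{i\,2^{-l_j}:1\le i\le 2^{l_j}-1\bigr\}.$$ A truncated sparse grid of size $n$ is a set $\mathcal X_\tau^{\mathsf{SG}}\cup A$, where $\tau\ge1$ satisfies $|\mathcal X_\tau^{\mathsf{SG}}|\le n<|\mathcal X_{\tau+1}^{\mathsf{SG}}|$ and $A\subseteq\mathcal X_{\tau+1}^{\mathsf{SG}}\setminus\mathcal X_\tau^{\mathsf{SG}}$ has $n-|\mathcal X_\tau^{\mathsf{SG}}|$ elements. Then there is a constant $C>0$, depending only on $d$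 and $k$, such that for every integer $n\ge2$, all points $\mathbf x_1,\dots,\mathbf x_n$ that form a truncated sparse grid of size $n$, and every $f\in\mathscr H_k((0,1)^d)$, the function $f$ is square integrable on $(0,1)^d$ and $$\|f\|_2\le C\Bigl((\log n)^{\frac{3(d-1)}2}\,\|f\|_n+n^{-1}(\log n)^{2(d-1)}\,\|f\|_{\mathscr H_k((0,1)^d)}\Bigr),$$ where $\|f\|_2$ is the norm of $L^2((0,1)^d)$ and $\|f\|_n=\bigl(\frac1n\sum_{i=1}^n f(\mathbf x_i)^2\bigr)^{1/2}$ is the empirical semi-norm. -/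

import Mathlib

open MeasureTheory Set
open scoped ENNReal

noncomputable section

namespace SparseGrid

/-! ### Scalar kernels and their reproducing kernel Hilbert spaces -/

/-- A real-valued kernel, seen as an operator-valued kernel in the format of Mathlib's `RKHS`. -/
def scalarKernel {X : Type*} (k : X → X → ℝ) : Matrix X X (ℝ →L[ℝ] ℝ) :=
  Matrix.of fun x y => k x y • ContinuousLinearMap.id ℝ ℝ

/-- Products of kernels `min (r x) (r y)` with positive `r`, rescaled by a function `c`, are
positive semidefinite. -/
theorem posSemidef_scalarKernel_min {X ι : Type*} [Fintype ι] (c : X → ℝ) (r : ι → X → ℝ)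
    (hr : ∀ i x, 0 < r i x) (k : X → X → ℝ)
    (hk : ∀ x y, k x y = c x * c y * ∏ i, min (r i x) (r i y)) :
    (scalarKernel k).PosSemidef := by
  classical
  suffices h : (scalarKernel k).IsHermitian ∧ ∀ vv : X →₀ ℝ,
      0 ≤ RCLike.re (vv.sum fun x w => vv.sum fun x' w' =>
        inner ℝ ((scalarKernel k) x' x w) w') from
    (RKHS.posSemidef_tfae.out 0 2).mpr h
  refine ⟨?_, ?_⟩
  · have hid : ContinuousLinearMap.adjoint (ContinuousLinearMap.id ℝ ℝ) =
        ContinuousLinearMap.id ℝ ℝ :=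
      star_one (R := ℝ →L[ℝ] ℝ)
    ext x y
    simp [scalarKernel, Matrix.conjTranspose_apply, hk, mul_comm, min_comm,
      ContinuousLinearMap.star_eq_adjoint, hid]
  · intro vv
    set A : X → Set (ι → ℝ) := fun x => Set.pi univ fun i => Ioc 0 (r i x) with hA
    have hAm : ∀ x, MeasurableSet (A x) := fun x =>
      MeasurableSet.univ_pi fun i => measurableSet_Ioc
    have hAA : ∀ x y, A x ∩ A y = Set.pi univ fun i => Ioc 0 (min (r i x) (r i y)) := by
      intro x y
      rw [hA]
      simp only [← Set.pi_inter_distrib, Ioc_inter_Ioc, max_self]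
    have hvol : ∀ x y, volume.real (A x ∩ A y) = ∏ i, min (r i x) (r i y) := by
      intro x y
      rw [hAA, Measure.real, Real.volume_pi_Ioc_toReal]
      · simp
      · intro i
        exact (lt_min (hr i x) (hr i y)).le
    have hfin : ∀ x y, volume (A x ∩ A y) ≠ ∞ := by
      intro x y
      rw [hAA, Real.volume_pi_Ioc]
      exact ENNReal.prod_ne_top fun i _ => ENNReal.ofReal_ne_top
    set g : X → (ι → ℝ) → ℝ := fun x => (A x).indicator fun _ => 1 with hg
    have hgg : ∀ x y u, g x u * g y u = (A x ∩ A y).indicator (fun _ => (1 : ℝ)) u := by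
      intro x y u
      by_cases hx : u ∈ A x <;> by_cases hy : u ∈ A y <;> simp [hg, hx, hy]
    have hint : ∀ x y, Integrable (fun u => g x u * g y u) := by
      intro x y
      simp_rw [hgg]
      exact (integrable_indicator_iff ((hAm x).inter (hAm y))).mpr
        (integrableOn_const (hfin x y))
    have hval : ∀ x y, ∫ u, g x u * g y u = ∏ i, min (r i x) (r i y) := by
      intro x y
      simp_rw [hgg]
      rw [integral_indicator ((hAm x).inter (hAm y)), ← hvol]
      simp
    have key : (vv.sum fun x w => vv.sum fun x' w' =>
        inner ℝ ((scalarKernel k) x' x w) w') =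
        ∫ u, (∑ x ∈ vv.support, vv x * c x * g x u) ^ 2 := by
      have h1 : ∀ u, (∑ x ∈ vv.support, vv x * c x * g x u) ^ 2 =
          ∑ x ∈ vv.support, ∑ y ∈ vv.support,
            (vv x * c x * (vv y * c y)) * (g x u * g y u) := by
        intro u
        rw [sq, Finset.sum_mul_sum]
        exact Finset.sum_congr rfl fun x _ => Finset.sum_congr rfl fun y _ => by ring
      simp_rw [h1]
      rw [integral_finsetSum _ fun x _ => integrable_finsetSum _ fun y _ =>
        (hint x y).const_mul _]
      refine Finset.sum_congr rfl fun x _ => ?_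
      rw [integral_finsetSum _ fun y _ => (hint x y).const_mul _]
      refine Finset.sum_congr rfl fun y _ => ?_
      rw [integral_const_mul, hval]
      simp [scalarKernel, hk, min_comm]
      ring
    rw [key]
    exact integral_nonneg fun u => sq_nonneg _

section Restriction

variable {E : Type*} {I : Set E} (K : Matrix I I (ℝ →L[ℝ] ℝ)) [Fact K.PosSemidef]

/-- The elements of the reproducing kernel Hilbert space of `K` (a space of functions on `I`)
that coincide with `g` on `X₀`. -/
def extensions (X₀ : Set E) (g : E → ℝ) : Set (RKHS.OfKernel K) :=
  {h | ∀ x : I, (x : E) ∈ X₀ → h x = g x}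

/-- `g`, as a function on `X₀`, is the restriction to `X₀` of an element of the reproducing kernel
Hilbert space of `K`. -/
def MemRestrict (X₀ : Set E) (g : E → ℝ) : Prop := (extensions K X₀ g).Nonempty

/-- The norm of `g` in the restriction to `X₀` of the reproducing kernel Hilbert space of `K`:
the infimum of the norms of all extensions of `g`. Meaningful if `MemRestrict K X₀ g`. -/
def restrictNorm (X₀ : Set E) (g : E → ℝ) : ℝ := sInf ((fun h => ‖h‖) '' extensions K X₀ g)

end Restriction

/-! ### Tensor Markov kernels -/

/-- The data of a tensor Markov kernel
`k(x, x') = ∏ j, p j (min (x j) (x' j)) * q j (max (x j) (x' j))`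
on the box `∏ j, (a j, b j)`, whose sides may be unbounded. -/
structure TMKernel (d : ℕ) where
  a : Fin d → EReal
  b : Fin d → EReal
  p : Fin d → ℝ → ℝ
  q : Fin d → ℝ → ℝ
  p_pos : ∀ j (x : ℝ), a j < x → x < b j → 0 < p j x
  q_pos : ∀ j (x : ℝ), a j < x → x < b j → 0 < q j x
  strictMono : ∀ j, StrictMonoOn (fun x => p j x / q j x) {x : ℝ | a j < x ∧ x < b j}

namespace TMKernel

variable {d : ℕ} (T : TMKernel d)

/-- The open interval `(a j, b j)`. -/
def side (j : Fin d) : Set ℝ := {x | T.a j < x ∧ x < T.b j}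

/-- The box `∏ j, (a j, b j)`. -/
def box : Set (Fin d → ℝ) := {x | ∀ j, x j ∈ T.side j}

/-- The one-dimensional factor `k_j(x, x') = p j (min x x') * q j (max x x')`. -/
def factor (j : Fin d) (x y : ℝ) : ℝ := T.p j (min x y) * T.q j (max x y)

/-- The factor `k_j` as a kernel on `(a j, b j)`. -/
def kernel₁ (j : Fin d) : Matrix (T.side j) (T.side j) (ℝ →L[ℝ] ℝ) :=
  scalarKernel fun x y => T.factor j x y

/-- The tensor Markov kernel as a kernel on the box. -/
def kernel : Matrix T.box T.box (ℝ →L[ℝ] ℝ) :=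
  scalarKernel fun x y => ∏ j, T.factor j (x.1 j) (y.1 j)

theorem factor_eq (j : Fin d) {x y : ℝ} (hx : x ∈ T.side j) (hy : y ∈ T.side j) :
    T.factor j x y = T.q j x * T.q j y * min (T.p j x / T.q j x) (T.p j y / T.q j y) := by
  have hqx := (T.q_pos j x hx.1 hx.2).ne'
  have hqy := (T.q_pos j y hy.1 hy.2).ne'
  rcases le_total x y with h | h
  · have := (T.strictMono j).monotoneOn hx hy h
    rw [factor, min_eq_left h, max_eq_right h, min_eq_left this]
    field_simp
  · have := (T.strictMono j).monotoneOn hy hx h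
    rw [factor, min_eq_right h, max_eq_left h, min_eq_right this]
    field_simp

instance (j : Fin d) : Fact (T.kernel₁ j).PosSemidef :=
  ⟨posSemidef_scalarKernel_min (ι := Unit) (fun x : T.side j => T.q j x)
    (fun _ (x : T.side j) => T.p j x / T.q j x)
    (fun _ x => div_pos (T.p_pos j x x.2.1 x.2.2) (T.q_pos j x x.2.1 x.2.2)) _
    (fun x y => by simpa using T.factor_eq j x.2 y.2)⟩

instance : Fact T.kernel.PosSemidef :=
  ⟨posSemidef_scalarKernel_min (ι := Fin d) (fun x : T.box => ∏ j, T.q j (x.1 j))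
    (fun j (x : T.box) => T.p j (x.1 j) / T.q j (x.1 j))
    (fun j x => div_pos (T.p_pos j _ (x.2 j).1 (x.2 j).2) (T.q_pos j _ (x.2 j).1 (x.2 j).2)) _
    (fun x y => by
      rw [← Finset.prod_mul_distrib, ← Finset.prod_mul_distrib]
      exact Finset.prod_congr rfl fun j _ => T.factor_eq j (x.2 j) (y.2 j))⟩

end TMKernel

/-! ### The Sobolev space of order one on the unit interval -/

/-- `g` and `g'` are square integrable on `(0, 1)` and `g'` is the weak derivative of `g` there. -/
structure IsH1 (g g' : ℝ → ℝ) : Prop where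
  memLp : MemLp g 2 (volume.restrict (Ioo 0 1))
  memLp_deriv : MemLp g' 2 (volume.restrict (Ioo 0 1))
  weakDeriv : ∀ φ : ℝ → ℝ, ContDiff ℝ (⊤ : ℕ∞) φ → HasCompactSupport φ →
    tsupport φ ⊆ Ioo 0 1 →
    ∫ x in Ioo (0 : ℝ) 1, g x * deriv φ x = -∫ x in Ioo (0 : ℝ) 1, g' x * φ x

/-- The standing regularity of the kernel: each interval `(a j, b j)` contains `(0, 1)`, the
functions `p j` and `q j` are continuous on it, and the restriction to `(0, 1)` of the reproducing
kernel Hilbert space of the factor `k_j` is the Sobolev space of order one (in its continuous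
representatives), with comparable norms. -/
structure TMKernel.Regular {d : ℕ} (T : TMKernel d) : Prop where
  a_le : ∀ j, T.a j ≤ 0
  le_b : ∀ j, 1 ≤ T.b j
  continuous_p : ∀ j, ContinuousOn (T.p j) (T.side j)
  continuous_q : ∀ j, ContinuousOn (T.q j) (T.side j)
  lower : ∀ j, ∃ c : ℝ, 0 < c ∧ ∀ g : ℝ → ℝ, MemRestrict (T.kernel₁ j) (Ioo 0 1) g →
    ∃ g' : ℝ → ℝ, IsH1 g g' ∧
      c * ∫ x in Ioo (0 : ℝ) 1, g' x ^ 2 ≤ restrictNorm (T.kernel₁ j) (Ioo 0 1) g ^ 2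
  upper : ∀ j, ∃ c : ℝ, 0 < c ∧ ∀ g g' : ℝ → ℝ, ContinuousOn g (Ioo 0 1) → IsH1 g g' →
    MemRestrict (T.kernel₁ j) (Ioo 0 1) g ∧
      restrictNorm (T.kernel₁ j) (Ioo 0 1) g ^ 2 ≤
        c * ((∫ x in Ioo (0 : ℝ) 1, g x ^ 2) + ∫ x in Ioo (0 : ℝ) 1, g' x ^ 2)

/-- The design space `(0, 1)^d`. -/
def unitCube (d : ℕ) : Set (Fin d → ℝ) := {x | ∀ j, x j ∈ Ioo (0 : ℝ) 1}

/-- `f`, as a function on `(0, 1)^d`, belongs to the restriction of the reproducing kernel Hilbert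
space of the tensor Markov kernel. -/
def TMKernel.Mem {d : ℕ} (T : TMKernel d) (f : (Fin d → ℝ) → ℝ) : Prop :=
  MemRestrict T.kernel (unitCube d) f

/-- The norm of that restricted space. -/
def TMKernel.norm {d : ℕ} (T : TMKernel d) (f : (Fin d → ℝ) → ℝ) : ℝ :=
  restrictNorm T.kernel (unitCube d) f

/-! ### Sparse grids -/

open scoped Classical in
/-- The points `i / 2 ^ l` with `1 ≤ i ≤ 2 ^ l - 1`. -/
def dyadicGrid (l : ℕ) : Finset ℝ :=
  (Finset.Icc 1 (2 ^ l - 1)).image fun i : ℕ => (i : ℝ) / 2 ^ l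

open scoped Classical in
/-- The classical sparse grid of level `τ`: the union of the full grids of levels
`l = (l_1, …, l_d)` with all `l_j ≥ 1` and `l_1 + ⋯ + l_d ≤ τ + d - 1`. (The bound on the single
`l_j` in the index set follows from the bound on the sum.) -/
def sparseGrid (d τ : ℕ) : Finset (Fin d → ℝ) :=
  ((Fintype.piFinset fun _ : Fin d => Finset.Icc 1 (τ + d - 1)).filter
    fun l => ∑ j, l j ≤ τ + d - 1).biUnion fun l => Fintype.piFinset fun j => dyadicGrid (l j)

open scoped Classical in
/-- `S` is a truncated sparse grid of size `n`. -/
def IsTruncatedSparseGrid (d n : ℕ) (S : Finset (Fin d → ℝ)) : Prop :=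
  ∃ τ : ℕ, 1 ≤ τ ∧ (sparseGrid d τ).card ≤ n ∧ n < (sparseGrid d (τ + 1)).card ∧
    ∃ A ⊆ sparseGrid d (τ + 1) \ sparseGrid d τ,
      A.card = n - (sparseGrid d τ).card ∧ S = sparseGrid d τ ∪ A

open scoped Classical in
/-- The points `x 0, …, x (n - 1)` form a truncated sparse grid of size `n`. (They are then
pairwise distinct, since their set has `n` elements.) -/
def FormTruncatedSparseGrid {d n : ℕ} (x : Fin n → Fin d → ℝ) : Prop :=
  IsTruncatedSparseGrid d n (Finset.univ.image x)

/-- The empirical semi-norm at the design points `x 0, …, x (n - 1)`. -/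
def empiricalNorm {d n : ℕ} (x : Fin n → Fin d → ℝ) (f : (Fin d → ℝ) → ℝ) : ℝ :=
  √((1 / (n : ℝ)) * ∑ i, f (x i) ^ 2)

end SparseGrid

end

/-!
For `h` in the reproducing kernel Hilbert space of the tensor kernel, sampling `h` at the nodes of
the full grid of level `L` is a tensor product of one-dimensional sampling operators. In each
coordinate the embedding into the Sobolev space of order one bounds the difference between sampling
at level `m` and at level `n ≤ m` by `2⁻ⁿ ‖h‖`. An operator bound `‖U G^{1/2}‖² ≤ M`, where `G` is
the Gram matrix of the kernel sections at the nodes, says that `U G Uᵀ ≤ M` for the Loewner order,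
and Kronecker products respect this order; so the increments of levels `n₁, …, n_d` have norm at
most `2 ^ (-(n₁ + ⋯ + n_d)) ‖h‖` up to a constant, without any appeal to mixed derivatives in `d`
variables.

Splitting the full-grid operator into such increments, as in Smolyak's construction, those of total
level above `τ` sum up to `τ^{d-1} 2^{-τ} ‖h‖`. The others regroup into at most `τ^{d-1}` terms that
only involve the values of `h` on the sparse grid of level `τ`, and the normalised `ℓ²` norm of each
is at most `2^{-τ/2}` times that of these values. Letting `L → ∞`, Fatou's lemma turns the bound
on the full grids into one on the `L²` norm. Finally `n` is at most a constant times
`τ^{d-1} 2^τ`, and `τ` at most a constant times `log n`.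
-/

noncomputable section

namespace SparseGrid

section PiKronecker

open Matrix
open scoped MatrixOrder

theorem of_prod_mono {J n : Type*} [Finite n] (s : Finset J) {A B : J → Matrix n n ℝ}
    (hA : ∀ j, 0 ≤ A j) (hAB : ∀ j, A j ≤ B j) :
    0 ≤ (of fun c c' => ∏ j ∈ s, A j c c') ∧
      (of fun c c' => ∏ j ∈ s, A j c c') ≤ of fun c c' => ∏ j ∈ s, B j c c' := by
  classical
  have hadamard_nonneg {P Q : Matrix n n ℝ} (hP : 0 ≤ P) (hQ : 0 ≤ Q) : 0 ≤ P ⊙ Q :=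
    (hP.posSemidef.hadamard hQ.posSemidef).nonneg
  have of_prod_insert (A : J → Matrix n n ℝ) {i : J} {s : Finset J} (hi : i ∉ s) :
      (of fun c c' => ∏ j ∈ insert i s, A j c c') = A i ⊙ of fun c c' => ∏ j ∈ s, A j c c' := by
    ext c c'
    simp only [of_apply, hadamard_apply, Finset.prod_insert hi]
  induction s using Finset.induction_on with
  | empty =>
    have hone := posSemidef_gram ℝ fun _ : n => (1 : ℝ)
    refine ⟨?_, le_rfl⟩
    convert hone.nonneg using 1
    ext c c'
    simp [gram_apply]
  | insert i s hi ih =>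
    obtain ⟨ih_nonneg, ih_le⟩ := ih
    rw [of_prod_insert A hi, of_prod_insert B hi]
    refine ⟨hadamard_nonneg (hA i) ih_nonneg, sub_nonneg.1 ?_⟩
    convert add_nonneg (hadamard_nonneg (sub_nonneg.2 (hAB i)) (ih_nonneg.trans ih_le))
      (hadamard_nonneg (hA i) (sub_nonneg.2 ih_le)) using 1
    ext c c'
    simp only [hadamard_apply, of_apply, Matrix.sub_apply, Matrix.add_apply]
    ring

variable {J : Type*} [Fintype J] {ι κ : J → Type*}

/-- The Kronecker product `⨂ j, U j` of a family of matrices, its rows and columns being indexed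
by dependent functions. -/
def piKronecker (U : ∀ j, Matrix (ι j) (κ j) ℝ) : Matrix (∀ j, ι j) (∀ j, κ j) ℝ :=
  of fun c y => ∏ j, U j (c j) (y j)

theorem piKronecker_apply (U : ∀ j, Matrix (ι j) (κ j) ℝ) (c : ∀ j, ι j) (y : ∀ j, κ j) :
    piKronecker U c y = ∏ j, U j (c j) (y j) :=
  rfl

theorem piKronecker_transpose (U : ∀ j, Matrix (ι j) (κ j) ℝ) :
    (piKronecker U)ᵀ = piKronecker fun j => (U j)ᵀ :=
  rfl

theorem piKronecker_mul {μ : J → Type*} [DecidableEq J] [∀ j, Fintype (κ j)]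
    (U : ∀ j, Matrix (ι j) (κ j) ℝ) (V : ∀ j, Matrix (κ j) (μ j) ℝ) :
    piKronecker U * piKronecker V = piKronecker fun j => U j * V j := by
  ext c z
  simp only [mul_apply, piKronecker_apply, ← Finset.prod_mul_distrib, Fintype.prod_sum]

theorem piKronecker_smul_one [∀ j, DecidableEq (ι j)] (M : J → ℝ) :
    piKronecker (fun j => M j • (1 : Matrix (ι j) (ι j) ℝ)) = (∏ j, M j) • 1 := by
  ext c c'
  simp only [piKronecker_apply, Matrix.smul_apply, smul_eq_mul, Finset.prod_mul_distrib, one_apply,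
    Fintype.prod_ite_zero, Finset.prod_const_one, funext_iff]

theorem piKronecker_mono [∀ j, Finite (ι j)] {A B : ∀ j, Matrix (ι j) (ι j) ℝ}
    (hA : ∀ j, 0 ≤ A j) (hAB : ∀ j, A j ≤ B j) : piKronecker A ≤ piKronecker B := by
  refine (of_prod_mono (n := ∀ j, ι j) Finset.univ
    (A := fun j => (A j).submatrix (fun c : (∀ j, ι j) => c j) fun c => c j)
    (B := fun j => (B j).submatrix (fun c : (∀ j, ι j) => c j) fun c => c j)
    (fun j => ((hA j).posSemidef.submatrix _).nonneg) fun j => ?_).2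
  exact (le_iff.1 (hAB j)).submatrix fun c : (∀ j, ι j) => c j

end PiKronecker

section GramMatrix

open Matrix
open scoped MatrixOrder

variable {ι κ E : Type*} [NormedAddCommGroup E] [InnerProductSpace ℝ E]

theorem gram_sum_smul [Fintype κ] (U : Matrix ι κ ℝ) (v : κ → E) :
    gram ℝ (fun c => ∑ y, U c y • v y) = U * gram ℝ v * Uᵀ := by
  ext c c'
  simp only [gram_apply, mul_apply, transpose_apply, sum_inner, inner_sum, real_inner_smul_left,
    real_inner_smul_right, Finset.sum_mul]
  exact Finset.sum_congr rfl fun y _ => Finset.sum_congr rfl fun z _ => by ring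

variable [Fintype ι] [DecidableEq ι]

theorem gram_le_smul_one_iff_norm_sum_smul_sq_le {v : ι → E} {M : ℝ} :
    gram ℝ v ≤ M • (1 : Matrix ι ι ℝ) ↔
      ∀ y : ι → ℝ, ‖∑ c, y c • v c‖ ^ 2 ≤ M * ∑ c, y c ^ 2 := by
  have quadratic_form (y : ι → ℝ) : star y ⬝ᵥ ((M • (1 : Matrix ι ι ℝ) - gram ℝ v) *ᵥ y) =
      M * ∑ c, y c ^ 2 - ‖∑ c, y c • v c‖ ^ 2 := by
    rw [sub_mulVec, dotProduct_sub, star_dotProduct_gram_mulVec, real_inner_self_eq_norm_sq,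
      smul_mulVec, one_mulVec, dotProduct_smul, smul_eq_mul]
    simp only [dotProduct, star_trivial, sq]
  have hermitian : (M • (1 : Matrix ι ι ℝ) - gram ℝ v).IsHermitian :=
    ((isHermitian_one).smul (IsSelfAdjoint.all M)).sub (isHermitian_gram ℝ v)
  rw [le_iff, posSemidef_iff_dotProduct_mulVec]
  simp only [quadratic_form, sub_nonneg, hermitian, true_and]

theorem gram_le_smul_one_iff_sum_inner_sq_le {v : ι → E} {M : ℝ} (hM : 0 ≤ M) :
    gram ℝ v ≤ M • (1 : Matrix ι ι ℝ) ↔ ∀ g : E, ∑ c, inner ℝ (v c) g ^ 2 ≤ M * ‖g‖ ^ 2 := by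
  have inner_sum_smul (y : ι → ℝ) (g : E) :
      inner ℝ (∑ c, y c • v c) g = ∑ c, y c * inner ℝ (v c) g := by
    simp only [sum_inner, real_inner_smul_left]
  rw [gram_le_smul_one_iff_norm_sum_smul_sq_le]
  constructor
  · intro synthesis g
    set s := ∑ c, inner ℝ (v c) g ^ 2 with hs
    have hsq : s * s ≤ M * ‖g‖ ^ 2 * s := by
      calc s * s = inner ℝ (∑ c, inner ℝ (v c) g • v c) g ^ 2 := by
            simp only [inner_sum_smul, hs, sq]
        _ ≤ (‖∑ c, inner ℝ (v c) g • v c‖ * ‖g‖) ^ 2 :=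
            sq_le_sq' (neg_le_of_abs_le (abs_real_inner_le_norm _ _)) (real_inner_le_norm _ _)
        _ = ‖∑ c, inner ℝ (v c) g • v c‖ ^ 2 * ‖g‖ ^ 2 := mul_pow _ _ _
        _ ≤ M * s * ‖g‖ ^ 2 := by gcongr; exact synthesis _
        _ = M * ‖g‖ ^ 2 * s := by ring
    rcases (show 0 ≤ s by positivity).eq_or_lt with hs0 | hs0
    · rw [← hs0]; positivity
    · exact le_of_mul_le_mul_right hsq hs0
  · intro analysis y
    set g := ∑ c, y c • v c with hg
    have hsq : ‖g‖ ^ 2 * ‖g‖ ^ 2 ≤ M * (∑ c, y c ^ 2) * ‖g‖ ^ 2 := by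
      calc ‖g‖ ^ 2 * ‖g‖ ^ 2 = (∑ c, y c * inner ℝ (v c) g) ^ 2 := by
            rw [← inner_sum_smul, ← hg, real_inner_self_eq_norm_sq, ← sq]
        _ ≤ (∑ c, y c ^ 2) * ∑ c, inner ℝ (v c) g ^ 2 := Finset.sum_mul_sq_le_sq_mul_sq _ _ _
        _ ≤ (∑ c, y c ^ 2) * (M * ‖g‖ ^ 2) := by gcongr; exact analysis g
        _ = M * (∑ c, y c ^ 2) * ‖g‖ ^ 2 := by ring
    rcases (sq_nonneg ‖g‖).eq_or_lt with hg0 | hg0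
    · rw [← hg0]; positivity
    · exact le_of_mul_le_mul_right hsq hg0

end GramMatrix

section TensorSampling

open Matrix
open scoped MatrixOrder

variable {J : Type*} [Fintype J] {ι κ : J → Type*} [∀ j, Fintype (ι j)] [∀ j, Fintype (κ j)]
  {E : J → Type*} [∀ j, NormedAddCommGroup (E j)] [∀ j, InnerProductSpace ℝ (E j)]
  {H : Type*} [NormedAddCommGroup H] [InnerProductSpace ℝ H]

theorem sum_piKronecker_mulVec_inner_sq_le [DecidableEq J] (v : ∀ j, κ j → E j)
    (w : (∀ j, κ j) → H) (hw : ∀ y z, inner ℝ (w y) (w z) = ∏ j, inner ℝ (v j (y j)) (v j (z j)))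
    (U : ∀ j, Matrix (ι j) (κ j) ℝ) {M : J → ℝ} (hM : ∀ j, 0 ≤ M j)
    (hU : ∀ j g, ∑ c, (U j *ᵥ fun y => inner ℝ (v j y) g) c ^ 2 ≤ M j * ‖g‖ ^ 2) (h : H) :
    ∑ c, (piKronecker U *ᵥ fun y => inner ℝ (w y) h) c ^ 2 ≤ (∏ j, M j) * ‖h‖ ^ 2 := by
  classical
  have gram_w : gram ℝ w = piKronecker fun j => gram ℝ (v j) := by
    ext y z
    exact hw y z
  have gram_le : gram ℝ (fun c => ∑ y, piKronecker U c y • w y) ≤ (∏ j, M j) • 1 := by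
    rw [gram_sum_smul, gram_w, piKronecker_transpose, piKronecker_mul, piKronecker_mul,
      ← piKronecker_smul_one]
    simp only [← gram_sum_smul]
    exact piKronecker_mono (fun j => (posSemidef_gram ℝ _).nonneg) fun j =>
      (gram_le_smul_one_iff_sum_inner_sq_le (hM j)).2 fun g => by
        simpa only [mulVec, dotProduct, sum_inner, real_inner_smul_left] using hU j g
  convert (gram_le_smul_one_iff_sum_inner_sq_le (Finset.prod_nonneg fun j _ => hM j)).1
    gram_le h using 3 with c
  simp only [mulVec, dotProduct, sum_inner, real_inner_smul_left]

end TensorSampling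

section PiKroneckerMulVec

open Matrix

variable {J : Type*} [Fintype J] {ι κ : J → Type*} [∀ j, Fintype (κ j)]

/-- The vector `(⨂ j, U j) F`, as a multilinear function of the matrices `U j` with values in
Euclidean space. -/
def piKroneckerMulVec [DecidableEq J] (F : (∀ j, κ j) → ℝ) :
    MultilinearMap ℝ (fun j => Matrix (ι j) (κ j) ℝ) (EuclideanSpace ℝ (∀ j, ι j)) :=
  (WithLp.linearEquiv 2 ℝ ((∀ j, ι j) → ℝ)).symm.toLinearMap.compMultilinearMap <|
    MultilinearMap.pi fun c : ∀ j, ι j => ∑ y : ∀ j, κ j, F y •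
      (MultilinearMap.mkPiAlgebra ℝ J ℝ).compLinearMap fun j => entryLinearMap ℝ ℝ (c j) (y j)

theorem norm_piKroneckerMulVec_sq [DecidableEq J] [∀ j, Fintype (ι j)] (F : (∀ j, κ j) → ℝ)
    (U : ∀ j, Matrix (ι j) (κ j) ℝ) :
    ‖piKroneckerMulVec F U‖ ^ 2 = ∑ c, (piKronecker U *ᵥ F) c ^ 2 := by
  simp [piKroneckerMulVec, EuclideanSpace.norm_sq_eq, mulVec, dotProduct, piKronecker_apply,
    mul_comm]

end PiKroneckerMulVec

section SmolyakDecomposition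

theorem sum_half_pow_max_add_le (τ s L : ℕ) :
    ∑ r : Fin L, (1 / 2 : ℝ) ^ max τ (r + s) ≤ (τ + 2) * (1 / 2) ^ max τ s := by
  calc ∑ r : Fin L, (1 / 2 : ℝ) ^ max τ (r + s)
      ≤ ∑ r : Fin L, (1 / 2 : ℝ) ^ ((r : ℕ) - τ) * (1 / 2) ^ max τ s := by
        refine Finset.sum_le_sum fun r _ => ?_
        rw [← pow_add]
        exact pow_le_pow_of_le_one (by norm_num) (by norm_num) (by omega)
    _ = (∑ r ∈ Finset.range L, (1 / 2 : ℝ) ^ (r - τ)) * (1 / 2) ^ max τ s := by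
        rw [← Finset.sum_mul, Fin.sum_univ_eq_sum_range fun r => (1 / 2 : ℝ) ^ (r - τ)]
    _ ≤ (∑ r ∈ Finset.range (τ + L), (1 / 2 : ℝ) ^ (r - τ)) * (1 / 2) ^ max τ s := by
        gcongr
        omega
    _ = (∑ r ∈ Finset.range τ, (1 / 2 : ℝ) ^ (r - τ) + ∑ r ∈ Finset.range L, (1 / 2 : ℝ) ^ r) *
          (1 / 2) ^ max τ s := by
        simp only [Finset.sum_range_add, Nat.add_sub_cancel_left]
    _ ≤ (τ + 2) * (1 / 2) ^ max τ s := by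
        gcongr
        · simpa using Finset.sum_le_card_nsmul (Finset.range τ) _ 1
            fun r _ => pow_le_one₀ (n := r - τ) (by norm_num) (by norm_num : (1 / 2 : ℝ) ≤ 1)
        · exact sum_geometric_two_le L

theorem sum_half_pow_max_sum_add_le (D τ s L : ℕ) :
    ∑ ρ : Fin D → Fin L, (1 / 2 : ℝ) ^ max τ (∑ j, (ρ j : ℕ) + s) ≤
      (τ + 2) ^ D * (1 / 2) ^ max τ s := by
  induction D generalizing s with
  | zero => simp
  | succ D ih =>
    calc ∑ ρ : Fin (D + 1) → Fin L, (1 / 2 : ℝ) ^ max τ (∑ j, (ρ j : ℕ) + s)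
        = ∑ r : Fin L, ∑ ρ : Fin D → Fin L,
            (1 / 2 : ℝ) ^ max τ (∑ j, (ρ j : ℕ) + (r + s)) := by
          rw [← (Fin.consEquiv fun _ => Fin L).sum_comp, Fintype.sum_prod_type]
          simp only [Fin.consEquiv_apply, Fin.sum_univ_succ, Fin.cons_zero, Fin.cons_succ]
          exact Finset.sum_congr rfl fun r _ => Finset.sum_congr rfl fun ρ _ => by ring_nf
      _ ≤ ∑ r : Fin L, (τ + 2) ^ D * (1 / 2 : ℝ) ^ max τ (r + s) :=
          Finset.sum_le_sum fun r _ => ih (r + s)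
      _ ≤ (τ + 2) ^ D * ((τ + 2) * (1 / 2) ^ max τ s) := by
          rw [← Finset.mul_sum]
          gcongr
          exact sum_half_pow_max_add_le τ s L
      _ = (τ + 2) ^ (D + 1) * (1 / 2) ^ max τ s := by ring

theorem card_sum_lt_le_pow (D τ L : ℕ) :
    (Finset.univ.filter fun ρ : Fin D → Fin L => ∑ j, (ρ j : ℕ) < τ).card ≤ τ ^ D := by
  calc (Finset.univ.filter fun ρ : Fin D → Fin L => ∑ j, (ρ j : ℕ) < τ).card
      ≤ (Fintype.piFinset fun _ : Fin D => Finset.range τ).card := by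
        refine Finset.card_le_card_of_injOn (fun ρ j => (ρ j : ℕ)) (fun ρ hρ => ?_)
          fun ρ _ ρ' _ h => funext fun j => Fin.ext (congrFun h j)
        refine Fintype.mem_piFinset.2 fun j => Finset.mem_range.2 ?_
        exact (Finset.single_le_sum (f := fun j => (ρ j : ℕ)) (fun _ _ => Nat.zero_le _)
          (Finset.mem_univ j)).trans_lt (Finset.mem_filter.1 hρ).2
    _ = τ ^ D := by simp

theorem map_eq_sum_map_sub {R J W : Type*} [Semiring R] [Fintype J] [DecidableEq J] {V : J → Type*}
    [∀ j, AddCommGroup (V j)] [∀ j, Module R (V j)] [AddCommGroup W] [Module R W]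
    (S : MultilinearMap R V W) (A : ∀ j, ℕ → V j) (hA : ∀ j, A j 0 = 0) (L : ℕ) :
    S (fun j => A j L) = ∑ ρ : J → Fin L, S fun j => A j (ρ j + 1) - A j (ρ j) := by
  rw [← S.map_sum fun j (r : Fin L) => A j (r + 1) - A j r]
  congr with j
  rw [Fin.sum_univ_eq_sum_range fun r => A j (r + 1) - A j r, Finset.sum_range_sub, hA, sub_zero]

variable {W : Type*} [SeminormedAddCommGroup W] [NormedSpace ℝ W]

theorem norm_map_sub_le_two_pow_mul {J : Type*} [Fintype J] [DecidableEq J] {V : J → Type*}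
    [∀ j, AddCommGroup (V j)] [∀ j, Module ℝ (V j)] (R : MultilinearMap ℝ V W) (a b : ∀ j, V j)
    {q : ℝ} (hq : ∀ s : Finset J, ‖R (s.piecewise a b)‖ ≤ q) :
    ‖R (a - b)‖ ≤ 2 ^ Fintype.card J * q := by
  have norm_signed (s : Finset J) : ‖R (s.piecewise a (-b))‖ = ‖R (s.piecewise a b)‖ := by
    have hsmul : s.piecewise a (-b) =
        fun j => (if j ∈ s then (1 : ℝ) else -1) • s.piecewise a b j := by
      ext j
      by_cases hj : j ∈ s <;> simp [hj]
    rw [hsmul, R.map_smul_univ, norm_smul, norm_prod, Finset.prod_eq_one, one_mul]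
    intro j _
    split_ifs <;> simp
  rw [sub_eq_add_neg, R.map_add_univ]
  calc ‖∑ s : Finset J, R (s.piecewise a (-b))‖ ≤ ∑ s : Finset J, ‖R (s.piecewise a (-b))‖ :=
        norm_sum_le _ _
    _ ≤ ∑ _s : Finset J, q := Finset.sum_le_sum fun s _ => (norm_signed s).trans_le (hq s)
    _ = 2 ^ Fintype.card J * q := by simp

variable {D : ℕ} {V : Fin (D + 1) → Type*} [∀ j, AddCommGroup (V j)] [∀ j, Module ℝ (V j)]

theorem norm_map_cons_sub_le_two_pow_mul (S : MultilinearMap ℝ V W) (A : ∀ j, ℕ → V j) {q : ℝ}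
    {τ L : ℕ}
    (stable : ∀ l : Fin (D + 1) → ℕ, (∀ j, l j ≤ L) → τ ≤ ∑ j, l j → ∑ j, l j ≤ τ + D →
      ‖S fun j => A j (l j)‖ ≤ q) (hL : τ ≤ L) {ρ : Fin D → Fin L} (hρ : ∑ j, (ρ j : ℕ) < τ) :
    ‖S.curryLeft (A 0 (τ - ∑ j, (ρ j : ℕ)))
      fun j : Fin D => A j.succ (ρ j + 1) - A j.succ (ρ j)‖ ≤ 2 ^ D * q := by
  have two_pow_terms := norm_map_sub_le_two_pow_mul (S.curryLeft (A 0 (τ - ∑ j, (ρ j : ℕ))))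
    (fun j => A j.succ (ρ j + 1)) (fun j => A j.succ (ρ j)) (q := q) fun s => ?_
  · rwa [Fintype.card_fin] at two_pow_terms
  · set l : Fin (D + 1) → ℕ :=
      Fin.cons (τ - ∑ j, (ρ j : ℕ)) fun j => ρ j + if j ∈ s then 1 else 0 with hl
    have sum_l : ∑ j, l j = τ + s.card := by
      have sum_succ : ∑ j : Fin D, l j.succ = ∑ j, (ρ j : ℕ) + s.card := by
        simp [hl, Finset.sum_add_distrib]
      rw [Fin.sum_univ_succ, sum_succ, hl, Fin.cons_zero]
      omega
    have card_s : s.card ≤ D := s.card_le_univ.trans_eq (Fintype.card_fin D)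
    convert stable l (Fin.cases ?_ fun j => ?_) (by omega) (by omega) using 2
    · rw [MultilinearMap.curryLeft_apply]
      congr with j
      refine Fin.cases rfl (fun j => ?_) j
      by_cases hj : j ∈ s <;> simp [hl, hj]
    · exact (Nat.sub_le _ _).trans hL
    · have := (ρ j).2
      simp only [hl, Fin.cons_succ]
      split_ifs <;> omega

theorem map_eq_sum_curryLeft_sub_add_sum_curryLeft (S : MultilinearMap ℝ V W) (A : ∀ j, ℕ → V j)
    (hA : ∀ j, A j 0 = 0) (L : ℕ) (r : (Fin D → Fin L) → ℕ) :
    S (fun j => A j L) =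
      ∑ ρ, S.curryLeft (A 0 L - A 0 (r ρ)) (fun j => A j.succ (ρ j + 1) - A j.succ (ρ j)) +
        ∑ ρ, S.curryLeft (A 0 (r ρ)) fun j => A j.succ (ρ j + 1) - A j.succ (ρ j) := by
  rw [← Finset.sum_add_distrib]
  simp only [← _root_.add_apply, ← map_add, sub_add_cancel]
  rw [← map_eq_sum_map_sub (S.curryLeft (A 0 L)) (fun j => A j.succ) fun j => hA j.succ]
  exact congrArg S (Fin.cons_self_tail fun j => A j L).symm

/- The first coordinate is split at the level that brings the total level of the increments in the
other coordinates up to `τ`: what lies above is small because each increment is, and what remains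
consists of evaluations on the grids of total level between `τ` and `τ + D`. -/
theorem norm_map_le_of_approx_of_stable (S : MultilinearMap ℝ V W) (A : ∀ j, ℕ → V j)
    (hA : ∀ j, A j 0 = 0) {K q : ℝ} (hq : 0 ≤ q) {τ L : ℕ} (hL : τ ≤ L)
    (approx : ∀ m n : Fin (D + 1) → ℕ, n ≤ m → (∀ j, m j ≤ L) →
      ‖S fun j => A j (m j) - A j (n j)‖ ≤ K * (1 / 2) ^ ∑ j, n j)
    (stable : ∀ l : Fin (D + 1) → ℕ, (∀ j, l j ≤ L) → τ ≤ ∑ j, l j → ∑ j, l j ≤ τ + D →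
      ‖S fun j => A j (l j)‖ ≤ q) :
    ‖S fun j => A j L‖ ≤ K * ((τ + 2) ^ D * (1 / 2) ^ τ) + τ ^ D * (2 ^ D * q) := by
  have hK : 0 ≤ K := by
    simpa using (norm_nonneg _).trans (approx 0 0 le_rfl fun _ => Nat.zero_le L)
  set Δ : (Fin D → Fin L) → ∀ j : Fin D, V j.succ :=
    fun ρ j => A j.succ (ρ j + 1) - A j.succ (ρ j)
  set rest : (Fin D → Fin L) → ℕ := fun ρ => τ - ∑ j, (ρ j : ℕ) with hrest
  have upper (ρ : Fin D → Fin L) : ‖S.curryLeft (A 0 L - A 0 (rest ρ)) (Δ ρ)‖ ≤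
      K * (1 / 2) ^ max τ (∑ j, (ρ j : ℕ) + 0) := by
    convert approx (Fin.cons L fun j => ρ j + 1) (Fin.cons (rest ρ) fun j => ρ j)
      (Fin.cases ((Nat.sub_le _ _).trans hL) fun j => Nat.le_succ _)
      (Fin.cases le_rfl fun j => (ρ j).2) using 2
    · rw [MultilinearMap.curryLeft_apply]
      congr with j
      exact Fin.cases rfl (fun j => rfl) j
    · rw [Fin.sum_univ_succ]
      simp only [Fin.cons_zero, Fin.cons_succ, hrest]
      congr 1
      omega
  have lower (ρ : Fin D → Fin L) : ‖S.curryLeft (A 0 (rest ρ)) (Δ ρ)‖ ≤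
      if ∑ j, (ρ j : ℕ) < τ then 2 ^ D * q else 0 := by
    split_ifs with hρ
    · exact norm_map_cons_sub_le_two_pow_mul S A stable hL hρ
    · simp [hrest, Nat.sub_eq_zero_of_le (not_lt.1 hρ), hA]
  rw [map_eq_sum_curryLeft_sub_add_sum_curryLeft S A hA L rest]
  refine (norm_add_le _ _).trans (add_le_add ?_ ?_)
  · refine (norm_sum_le_of_le _ fun ρ _ => upper ρ).trans ?_
    rw [← Finset.mul_sum]
    gcongr
    simpa using sum_half_pow_max_sum_add_le D τ 0 L
  · refine (norm_sum_le_of_le _ fun ρ _ => lower ρ).trans ?_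
    rw [← Finset.sum_filter, Finset.sum_const, nsmul_eq_mul]
    gcongr
    exact_mod_cast card_sum_lt_le_pow D τ L

end SmolyakDecomposition

section WeakDerivative

theorem sq_integral_le_measureReal_mul_integral_sq {α : Type*} {m : MeasurableSpace α}
    {μ : Measure α} [IsFiniteMeasure μ] {u : α → ℝ} (hu : MemLp u 2 μ) :
    (∫ x, u x ∂μ) ^ 2 ≤ μ.real univ * ∫ x, u x ^ 2 ∂μ := by
  rcases eq_zero_or_neZero μ with rfl | _
  · simp
  have jensen : (⨍ x, u x ∂μ) ^ 2 ≤ ⨍ x, u x ^ 2 ∂μ :=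
    even_two.convexOn_pow.map_average_le (by fun_prop) isClosed_univ (by simp)
      (hu.integrable one_le_two) hu.integrable_sq
  rw [average_eq, average_eq, smul_eq_mul, smul_eq_mul] at jensen
  have hpos : 0 < μ.real univ := measureReal_univ_pos
  calc (∫ x, u x ∂μ) ^ 2 = μ.real univ ^ 2 * ((μ.real univ)⁻¹ * ∫ x, u x ∂μ) ^ 2 := by field_simp
    _ ≤ μ.real univ ^ 2 * ((μ.real univ)⁻¹ * ∫ x, u x ^ 2 ∂μ) := by gcongr
    _ = μ.real univ * ∫ x, u x ^ 2 ∂μ := by field_simp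

/-- A smooth step from `0` to `1` across the interval `[r, r + ε]`, used to build test functions
whose derivatives concentrate at two points. -/
def smoothStep (r ε x : ℝ) : ℝ := Real.smoothTransition ((x - r) / ε)

section SmoothStep

variable {r r' ε x a b : ℝ}

theorem contDiff_smoothStep {n : WithTop ℕ∞} (hn : n ≤ (⊤ : ℕ∞)) : ContDiff ℝ n (smoothStep r ε) :=
  (Real.smoothTransition.contDiff (n := ⊤)).of_le hn |>.comp
    ((contDiff_id.sub contDiff_const).div_const ε)

theorem smoothStep_nonneg : 0 ≤ smoothStep r ε x := Real.smoothTransition.nonneg _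

theorem smoothStep_le_one : smoothStep r ε x ≤ 1 := Real.smoothTransition.le_one _

theorem smoothStep_le_smoothStep (hε : 0 ≤ ε) (hr : r ≤ r') :
    smoothStep r' ε x ≤ smoothStep r ε x :=
  Real.smoothTransition.monotone (by gcongr)

theorem monotone_smoothStep (hε : 0 ≤ ε) : Monotone (smoothStep r ε) :=
  fun _ _ _ => Real.smoothTransition.monotone (by gcongr)

theorem smoothStep_of_le (hε : 0 ≤ ε) (hx : x ≤ r) : smoothStep r ε x = 0 :=
  Real.smoothTransition.zero_of_nonpos (div_nonpos_of_nonpos_of_nonneg (sub_nonpos.2 hx) hε)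

theorem smoothStep_of_add_le (hε : 0 < ε) (hx : r + ε ≤ x) : smoothStep r ε x = 1 :=
  Real.smoothTransition.one_of_one_le ((one_le_div hε).2 (by linarith))

theorem continuous_deriv_smoothStep : Continuous (deriv (smoothStep r ε)) :=
  (contDiff_smoothStep (n := 1) (mod_cast le_top)).continuous_deriv le_rfl

theorem deriv_smoothStep_nonneg (hε : 0 ≤ ε) : 0 ≤ deriv (smoothStep r ε) x :=
  (monotone_smoothStep hε).deriv_nonneg

theorem deriv_smoothStep_of_notMem (hε : 0 < ε) (hx : x ∉ Icc r (r + ε)) :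
    deriv (smoothStep r ε) x = 0 := by
  rcases lt_or_ge x r with hxr | hrx
  · have hconst : smoothStep r ε =ᶠ[nhds x] fun _ => 0 := by
      filter_upwards [Iio_mem_nhds hxr] with y hy using smoothStep_of_le hε.le (le_of_lt hy)
    rw [hconst.deriv_eq, deriv_const]
  · have hconst : smoothStep r ε =ᶠ[nhds x] fun _ => 1 := by
      filter_upwards [Ioi_mem_nhds (lt_of_not_ge fun h => hx ⟨hrx, h⟩)] with y hy
        using smoothStep_of_add_le hε (le_of_lt hy)
    rw [hconst.deriv_eq, deriv_const]

theorem integrableOn_deriv_smoothStep : IntegrableOn (deriv (smoothStep r ε)) (Ioo a b) :=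
  continuous_deriv_smoothStep.integrableOn_Icc.mono_set Ioo_subset_Icc_self

theorem setIntegral_deriv_smoothStep (hε : 0 < ε) (ha : a ≤ r) (hb : r + ε ≤ b) :
    ∫ x in Ioo a b, deriv (smoothStep r ε) x = 1 := by
  rw [← integral_Ioc_eq_integral_Ioo, ← intervalIntegral.integral_of_le (by linarith),
    intervalIntegral.integral_deriv_eq_sub
      (fun x _ => (contDiff_smoothStep (mod_cast le_top)).differentiable one_ne_zero x)
      (continuous_deriv_smoothStep.intervalIntegrable _ _),
    smoothStep_of_add_le hε hb, smoothStep_of_le hε.le ha, sub_zero]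

theorem integrableOn_mul_deriv_smoothStep {g : ℝ → ℝ} (hg : IntegrableOn g (Ioo a b)) :
    IntegrableOn (fun x => g x * deriv (smoothStep r ε) x) (Ioo a b) := by
  obtain ⟨B, hB⟩ := isCompact_Icc.exists_bound_of_continuousOn (s := Icc a b)
    continuous_deriv_smoothStep.continuousOn
  refine Integrable.mul_bdd (c := B) hg continuous_deriv_smoothStep.aestronglyMeasurable ?_
  filter_upwards [self_mem_ae_restrict measurableSet_Ioo] with x hx
    using hB x (Ioo_subset_Icc_self hx)

theorem abs_setIntegral_mul_deriv_smoothStep_sub_le {g : ℝ → ℝ} (hg : IntegrableOn g (Ioo a b))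
    {v η : ℝ} (hε : 0 < ε) (ha : a ≤ r) (hb : r + ε ≤ b)
    (hη : ∀ x ∈ Icc r (r + ε), |g x - v| ≤ η) :
    |(∫ x in Ioo a b, g x * deriv (smoothStep r ε) x) - v| ≤ η := by
  have hδ : IntegrableOn (deriv (smoothStep r ε)) (Ioo a b) := integrableOn_deriv_smoothStep
  have hmean (w : ℝ) : ∫ x in Ioo a b, w * deriv (smoothStep r ε) x = w := by
    rw [integral_const_mul, setIntegral_deriv_smoothStep hε ha hb, mul_one]
  calc |(∫ x in Ioo a b, g x * deriv (smoothStep r ε) x) - v|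
      = ‖∫ x in Ioo a b, (g x - v) * deriv (smoothStep r ε) x‖ := by
        simp_rw [sub_mul]
        rw [integral_sub (integrableOn_mul_deriv_smoothStep hg) (hδ.const_mul v), hmean,
          Real.norm_eq_abs]
    _ ≤ ∫ x in Ioo a b, η * deriv (smoothStep r ε) x := by
        refine norm_integral_le_of_norm_le (hδ.const_mul η) (.of_forall fun x => ?_)
        rw [norm_mul, Real.norm_eq_abs, Real.norm_of_nonneg (deriv_smoothStep_nonneg hε.le)]
        by_cases hx : x ∈ Icc r (r + ε)
        · exact mul_le_mul_of_nonneg_right (hη x hx) (deriv_smoothStep_nonneg hε.le)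
        · simp [deriv_smoothStep_of_notMem hε hx]
    _ = η := hmean η

theorem smoothStep_sub_eq_zero (hε : 0 < ε) (hr : r ≤ r') (hx : x ∉ Ioc r (r' + ε)) :
    smoothStep r ε x - smoothStep r' ε x = 0 := by
  rcases le_or_gt x r with hxr | hxr
  · rw [smoothStep_of_le hε.le hxr, smoothStep_of_le hε.le (hxr.trans hr), sub_self]
  · have hr'x : r' + ε < x := lt_of_not_ge fun h => hx ⟨hxr, h⟩
    rw [smoothStep_of_add_le hε (by linarith), smoothStep_of_add_le hε hr'x.le, sub_self]

theorem abs_smoothStep_sub_le_one (hε : 0 ≤ ε) (hr : r ≤ r') :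
    |smoothStep r ε x - smoothStep r' ε x| ≤ 1 := by
  rw [abs_of_nonneg (sub_nonneg.2 (smoothStep_le_smoothStep hε hr))]
  linarith [smoothStep_le_one (r := r) (ε := ε) (x := x),
    smoothStep_nonneg (r := r') (ε := ε) (x := x)]

end SmoothStep

namespace IsH1

variable {g g' : ℝ → ℝ} {s t : ℝ}

theorem abs_integral_deriv_smoothStep_sub_integral_le (h : IsH1 g g') {ε : ℝ} (hε : 0 < ε)
    (hs : 0 < s) (ht : t < 1) (hst : s ≤ t - ε) :
    |(∫ x in Ioo 0 1, g x * deriv (smoothStep s ε) x) -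
      ∫ x in Ioo 0 1, g x * deriv (smoothStep (t - ε) ε) x| ≤ ∫ x in Ioc s t, |g' x| := by
  set φ : ℝ → ℝ := fun x => smoothStep s ε x - smoothStep (t - ε) ε x with hφ
  have hφ_zero (x : ℝ) (hx : x ∉ Ioc s t) : φ x = 0 :=
    smoothStep_sub_eq_zero hε hst (by rwa [sub_add_cancel])
  have tsupport_φ : tsupport φ ⊆ Icc s t :=
    closure_minimal (fun x hx => Ioc_subset_Icc_self (of_not_not (mt (hφ_zero x) hx))) isClosed_Icc
  have hsub : Ioc s t ⊆ Ioo 0 1 := fun x hx => ⟨hs.trans hx.1, hx.2.trans_lt ht⟩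
  have hg : IntegrableOn g (Ioo 0 1) := h.memLp.integrable one_le_two
  have hg' : IntegrableOn g' (Ioo 0 1) := h.memLp_deriv.integrable one_le_two
  have smooth (r : ℝ) : ContDiff ℝ (⊤ : ℕ∞) (smoothStep r ε) := contDiff_smoothStep le_rfl
  have differentiable (r : ℝ) : Differentiable ℝ (smoothStep r ε) :=
    (smooth r).differentiable (by simp)
  calc |(∫ x in Ioo 0 1, g x * deriv (smoothStep s ε) x) -
        ∫ x in Ioo 0 1, g x * deriv (smoothStep (t - ε) ε) x|
      = |∫ x in Ioo 0 1, g x * deriv φ x| := by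
        rw [← integral_sub (integrableOn_mul_deriv_smoothStep hg)
          (integrableOn_mul_deriv_smoothStep hg)]
        simp only [hφ, deriv_fun_sub (differentiable _ _) (differentiable _ _), mul_sub]
    _ = ‖∫ x in Ioo 0 1, g' x * φ x‖ := by
        rw [h.weakDeriv φ ((smooth s).sub (smooth (t - ε)))
          (.of_support_subset_isCompact isCompact_Icc ((subset_tsupport _).trans tsupport_φ))
          (tsupport_φ.trans fun x hx => ⟨hs.trans_le hx.1, hx.2.trans_lt ht⟩), abs_neg,
          Real.norm_eq_abs]
    _ ≤ ∫ x in Ioo 0 1, (Ioc s t).indicator (fun x => |g' x|) x := by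
        refine norm_integral_le_of_norm_le (hg'.abs.indicator measurableSet_Ioc)
          (.of_forall fun x => ?_)
        by_cases hx : x ∈ Ioc s t
        · rw [indicator_of_mem hx, norm_mul]
          exact mul_le_of_le_one_right (abs_nonneg _) (abs_smoothStep_sub_le_one hε.le hst)
        · simp [hφ_zero x hx, hx]
    _ = ∫ x in Ioc s t, |g' x| := by
        rw [setIntegral_indicator measurableSet_Ioc, inter_eq_right.2 hsub]

theorem abs_sub_le (h : IsH1 g g') (hg : ContinuousOn g (Ioo 0 1)) (hs : s ∈ Ioo (0 : ℝ) 1)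
    (ht : t ∈ Ioo (0 : ℝ) 1) (hst : s < t) : |g t - g s| ≤ ∫ x in Ioc s t, |g' x| := by
  refine le_of_forall_pos_le_add fun η hη => ?_
  obtain ⟨δs, hδs, near_s⟩ := Metric.continuousAt_iff.1
    (hg.continuousAt (isOpen_Ioo.mem_nhds hs)) (η / 2) (half_pos hη)
  obtain ⟨δt, hδt, near_t⟩ := Metric.continuousAt_iff.1
    (hg.continuousAt (isOpen_Ioo.mem_nhds ht)) (η / 2) (half_pos hη)
  obtain ⟨ε, hε, hε_lt⟩ : ∃ ε > 0, ε < min (min δs δt) (t - s) :=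
    exists_between (by simp [hδs, hδt, hst])
  simp only [lt_min_iff] at hε_lt
  have s_pos : 0 < s := hs.1
  have t_lt_one : t < 1 := ht.2
  have hgi : IntegrableOn g (Ioo 0 1) := h.memLp.integrable one_le_two
  have approx_s := abs_setIntegral_mul_deriv_smoothStep_sub_le hgi (r := s) (v := g s)
    (η := η / 2) hε s_pos.le (by linarith) fun x hx => (near_s (by
      rw [Real.dist_eq, abs_of_nonneg] <;> linarith [hx.1, hx.2])).le
  have approx_t := abs_setIntegral_mul_deriv_smoothStep_sub_le hgi (r := t - ε)
    (v := g t) (η := η / 2) hε (by linarith) (by linarith) fun x hx => (near_t (by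
      rw [Real.dist_eq, abs_of_nonpos] <;> linarith [hx.1, hx.2])).le
  have bound := h.abs_integral_deriv_smoothStep_sub_integral_le hε s_pos t_lt_one (by linarith)
  rw [abs_le] at *
  constructor <;> linarith

theorem sq_sub_le (h : IsH1 g g') (hg : ContinuousOn g (Ioo 0 1)) (hs : s ∈ Ioo (0 : ℝ) 1)
    (ht : t ∈ Ioo (0 : ℝ) 1) (hst : s ≤ t) :
    (g t - g s) ^ 2 ≤ (t - s) * ∫ x in Ioc s t, g' x ^ 2 := by
  rcases hst.eq_or_lt with rfl | hst
  · simp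
  have hsub : Ioc s t ⊆ Ioo 0 1 := fun x hx => ⟨hs.1.trans hx.1, hx.2.trans_lt ht.2⟩
  have hg' : MemLp (fun x => |g' x|) 2 (volume.restrict (Ioc s t)) :=
    (h.memLp_deriv.mono_measure (Measure.restrict_mono hsub le_rfl)).abs
  calc (g t - g s) ^ 2 ≤ (∫ x in Ioc s t, |g' x|) ^ 2 :=
        sq_le_sq' (neg_le_of_abs_le (h.abs_sub_le hg hs ht hst))
          (le_of_abs_le (h.abs_sub_le hg hs ht hst))
    _ ≤ (t - s) * ∫ x in Ioc s t, g' x ^ 2 := by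
        simpa [hst.le] using sq_integral_le_measureReal_mul_integral_sq hg'

theorem sq_sub_le_of_mem_Icc (h : IsH1 g g') (hg : ContinuousOn g (Ioo 0 1)) {a b : ℝ}
    (ha : 0 ≤ a) (hb : b ≤ 1) (hs : s ∈ Icc a b ∩ Ioo 0 1) (ht : t ∈ Icc a b ∩ Ioo 0 1) :
    (g t - g s) ^ 2 ≤ (b - a) * ∫ x in Ioc a b, g' x ^ 2 := by
  wlog hst : s ≤ t generalizing s t
  · rw [sub_sq_comm]
    exact this ht hs (le_of_not_ge hst)
  have hsub : Ioc s t ⊆ Ioc a b := Ioc_subset_Ioc hs.1.1 ht.1.2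
  have integrable : IntegrableOn (fun x => g' x ^ 2) (Ioc a b) := by
    rw [integrableOn_Ioc_iff_integrableOn_Ioo]
    exact IntegrableOn.mono_set h.memLp_deriv.integrable_sq (Ioo_subset_Ioo ha hb)
  refine (h.sq_sub_le hg hs.2 ht.2 hst).trans ?_
  refine mul_le_mul (sub_le_sub ht.1.2 hs.1.1) ?_ (integral_nonneg fun x => sq_nonneg _)
    (by linarith [hs.1.1, ht.1.2])
  exact setIntegral_mono_set integrable (.of_forall fun x => sq_nonneg _) hsub.eventuallyLE

theorem abs_le_abs_add (h : IsH1 g g') (hg : ContinuousOn g (Ioo 0 1)) {B : ℝ} (hB : 0 ≤ B)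
    (hB' : ∫ x in Ioo (0 : ℝ) 1, g' x ^ 2 ≤ B ^ 2) (hs : s ∈ Ioo (0 : ℝ) 1)
    (ht : t ∈ Ioo (0 : ℝ) 1) : |g t| ≤ |g s| + B := by
  have sq_le := h.sq_sub_le_of_mem_Icc hg le_rfl le_rfl ⟨Ioo_subset_Icc_self hs, hs⟩
    ⟨Ioo_subset_Icc_self ht, ht⟩
  rw [sub_zero, one_mul, integral_Ioc_eq_integral_Ioo] at sq_le
  linarith [abs_sub_abs_le_abs_sub (g t) (g s), abs_le_of_sq_le_sq (sq_le.trans hB') hB]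

end IsH1

theorem sum_setIntegral_Ioc_div_eq {u : ℝ → ℝ} (hu : IntegrableOn u (Ioo 0 1)) {N : ℕ}
    (hN : N ≠ 0) :
    ∑ e ∈ Finset.range N, ∫ x in Ioc ((e : ℝ) / N) ((e + 1 : ℕ) / N), u x =
      ∫ x in Ioo 0 1, u x := by
  have hN' : (0 : ℝ) < N := by positivity
  have le_succ (e : ℕ) : (e : ℝ) / N ≤ (e + 1 : ℕ) / N := by gcongr; simp
  simp only [← intervalIntegral.integral_of_le (le_succ _)]
  rw [intervalIntegral.sum_integral_adjacent_intervals (a := fun e : ℕ => (e : ℝ) / N)]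
  · rw [Nat.cast_zero, zero_div, div_self hN'.ne', intervalIntegral.integral_of_le zero_le_one,
      integral_Ioc_eq_integral_Ioo]
  · intro e he
    rw [intervalIntegrable_iff_integrableOn_Ioo_of_le (le_succ e)]
    exact hu.mono_set (Ioo_subset_Ioo (by positivity)
      ((div_le_one hN').2 (by exact_mod_cast he)))

end WeakDerivative

section DyadicNodes

variable {L l n c : ℕ}

theorem dyadicGrid_subset_Ioo {y : ℝ} (hy : y ∈ dyadicGrid l) : y ∈ Ioo (0 : ℝ) 1 := by
  obtain ⟨i, hi, rfl⟩ := Finset.mem_image.1 hy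
  obtain ⟨one_le_i, i_le⟩ := Finset.mem_Icc.1 hi
  have i_lt : i < 2 ^ l := by have := Nat.one_le_two_pow (n := l); omega
  refine ⟨div_pos (by exact_mod_cast one_le_i) (by positivity), ?_⟩
  rw [div_lt_one (by positivity)]
  exact_mod_cast i_lt

theorem dyadicGrid_mono (hl : l ≤ L) : dyadicGrid l ⊆ dyadicGrid L := by
  intro y hy
  obtain ⟨i, hi, rfl⟩ := Finset.mem_image.1 hy
  obtain ⟨one_le_i, i_le⟩ := Finset.mem_Icc.1 hi
  have hpow : 2 ^ L = 2 ^ l * 2 ^ (L - l) := by rw [← pow_add, Nat.add_sub_cancel' hl]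
  have hpos : 0 < 2 ^ (L - l) := by positivity
  have i_lt : i < 2 ^ l := by have := Nat.one_le_two_pow (n := l); omega
  refine Finset.mem_image.2 ⟨i * 2 ^ (L - l), Finset.mem_Icc.2 ⟨Nat.mul_pos one_le_i hpos, ?_⟩, ?_⟩
  · exact Nat.le_sub_one_of_lt (hpow ▸ Nat.mul_lt_mul_of_pos_right i_lt hpos)
  · have hpow' : (2 : ℝ) ^ L = 2 ^ l * 2 ^ (L - l) := by exact_mod_cast hpow
    rw [hpow']
    push_cast
    field_simp

/-- The node of `dyadicGrid l` attached to the cell `[c / 2 ^ L, (c + 1) / 2 ^ L)`, where `l ≤ L`: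
the left end of the cell of level `l` that contains it or, as `0` is not a node, the first node
if that left end is `0`. -/
def dyadicNode (L l c : ℕ) : ℝ := ((max (c / 2 ^ (L - l)) 1 : ℕ) : ℝ) / 2 ^ l

theorem div_two_pow_sub_lt (hl : l ≤ L) (hc : c < 2 ^ L) : c / 2 ^ (L - l) < 2 ^ l := by
  rwa [Nat.div_lt_iff_lt_mul (by positivity), ← pow_add, Nat.add_sub_cancel' hl]

theorem dyadicNode_mem_dyadicGrid (hl : l ≤ L) (hl0 : l ≠ 0) (hc : c < 2 ^ L) :
    dyadicNode L l c ∈ dyadicGrid l := by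
  have := div_two_pow_sub_lt hl hc
  have := Nat.one_lt_two_pow hl0
  refine Finset.mem_image.2 ⟨_, Finset.mem_Icc.2 ⟨le_max_right _ _, ?_⟩, rfl⟩
  omega

theorem dyadicNode_mem_Icc (hn : n ≤ l) (hl : l ≤ L) :
    dyadicNode L l c ∈ Icc (((c / 2 ^ (L - n) : ℕ) : ℝ) / (2 ^ n : ℕ))
      ((c / 2 ^ (L - n) + 1 : ℕ) / (2 ^ n : ℕ)) := by
  set k := c / 2 ^ (L - l) with hk
  have cell_eq : c / 2 ^ (L - n) = k / 2 ^ (l - n) := by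
    rw [hk, Nat.div_div_eq_div_mul, ← pow_add]
    congr 2
    omega
  have hpos : 0 < 2 ^ (l - n) := by positivity
  have left_le : k / 2 ^ (l - n) * 2 ^ (l - n) ≤ max k 1 :=
    (Nat.div_mul_le_self _ _).trans (le_max_left _ _)
  have le_right : max k 1 ≤ (k / 2 ^ (l - n) + 1) * 2 ^ (l - n) :=
    max_le (mul_comm (2 ^ (l - n)) _ ▸ Nat.lt_mul_div_succ k hpos).le
      (Nat.mul_pos (Nat.succ_pos _) hpos)
  have hpow : (2 : ℝ) ^ l = (2 ^ n : ℕ) * 2 ^ (l - n) := by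
    push_cast
    rw [← pow_add, Nat.add_sub_cancel' hn]
  rw [cell_eq, dyadicNode, ← hk, hpow, mul_comm, ← div_div, mem_Icc]
  constructor <;> gcongr
  · rw [le_div_iff₀ (by positivity)]
    exact_mod_cast left_le
  · rw [div_le_iff₀ (by positivity)]
    exact_mod_cast le_right

theorem card_filter_dyadicNode_eq_le (y : ℝ) :
    (Finset.univ.filter fun c : Fin (2 ^ L) => dyadicNode L l c = y).card ≤ 2 * 2 ^ (L - l) := by
  classical
  set b := 2 ^ (L - l) with hb
  have hpos : 0 < b := by positivity
  rcases Finset.eq_empty_or_nonempty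
    (Finset.univ.filter fun c : Fin (2 ^ L) => dyadicNode L l c = y) with hempty | ⟨c₀, hc₀⟩
  · simp [hempty]
  set i := max (c₀ / b) 1 with hi
  have fiber_subset : (Finset.univ.filter fun c : Fin (2 ^ L) => dyadicNode L l c = y).image
      (fun c : Fin (2 ^ L) => (c : ℕ)) ⊆ Finset.Ico ((i - 1) * b) ((i + 1) * b) := by
    intro k hk
    obtain ⟨c, hc, rfl⟩ := Finset.mem_image.1 hk
    have same_node := (Finset.mem_filter.1 hc).2.trans (Finset.mem_filter.1 hc₀).2.symm
    rw [dyadicNode, dyadicNode, div_left_inj' (by positivity), Nat.cast_inj, ← hb, ← hi]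
      at same_node
    rw [Finset.mem_Ico, ← Nat.le_div_iff_mul_le hpos, ← Nat.div_lt_iff_lt_mul hpos]
    generalize (c : ℕ) / b = e at same_node ⊢
    clear_value i
    omega
  have one_le_i : 1 ≤ i := le_max_right _ _
  rw [← Finset.card_image_of_injective _ Fin.val_injective]
  refine (Finset.card_le_card fiber_subset).trans ?_
  rw [Nat.card_Ico, ← Nat.sub_mul]
  gcongr
  omega

theorem sum_fin_comp_div (hn : n ≤ L) (ψ : ℕ → ℝ) :
    ∑ c : Fin (2 ^ L), ψ (c / 2 ^ (L - n)) =
      2 ^ (L - n) * ∑ e ∈ Finset.range (2 ^ n), ψ e := by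
  have fiberwise (a : ℕ) {b : ℕ} (hb : 0 < b) :
      ∑ c ∈ Finset.range (a * b), ψ (c / b) = b * ∑ e ∈ Finset.range a, ψ e := by
    induction a with
    | zero => simp
    | succ a ih =>
      rw [add_mul, one_mul, Finset.sum_range_add, ih, Finset.sum_range_succ, mul_add,
        ← nsmul_eq_mul b (ψ a), ← Finset.card_range b, ← Finset.sum_const, Finset.card_range]
      refine congrArg _ (Finset.sum_congr rfl fun i hi => ?_)
      rw [mul_comm, Nat.mul_add_div hb, Nat.div_eq_of_lt (Finset.mem_range.1 hi), add_zero]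
  rw [Fin.sum_univ_eq_sum_range fun c => ψ (c / 2 ^ (L - n))]
  have := fiberwise (2 ^ n) (b := 2 ^ (L - n)) (by positivity)
  rw [← pow_add, Nat.add_sub_cancel' hn] at this
  exact_mod_cast this

theorem IsH1.sum_dyadicNode_sub_sq_le {g g' : ℝ → ℝ} (h : IsH1 g g')
    (hg : ContinuousOn g (Ioo 0 1)) {m : ℕ} (hn : n ≠ 0) (hnm : n ≤ m) (hm : m ≤ L) :
    ∑ c : Fin (2 ^ L), (g (dyadicNode L m c) - g (dyadicNode L n c)) ^ 2 ≤
      2 ^ L * ((1 / 2) ^ n) ^ 2 * ∫ x in Ioo (0 : ℝ) 1, g' x ^ 2 := by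
  have hnL := hnm.trans hm
  set energy : ℕ → ℝ :=
    fun e => ∫ x in Ioc ((e : ℝ) / (2 ^ n : ℕ)) ((e + 1 : ℕ) / (2 ^ n : ℕ)), g' x ^ 2
  have cell_bound (c : Fin (2 ^ L)) : (g (dyadicNode L m c) - g (dyadicNode L n c)) ^ 2 ≤
      (1 / 2) ^ n * energy (c / 2 ^ (L - n)) := by
    have right_le_one : (((c : ℕ) / 2 ^ (L - n) + 1 : ℕ) : ℝ) / (2 ^ n : ℕ) ≤ 1 :=
      (div_le_one (by positivity)).2 (Nat.cast_le.2 (div_two_pow_sub_lt hnL c.2))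
    convert h.sq_sub_le_of_mem_Icc hg (by positivity) right_le_one
      ⟨dyadicNode_mem_Icc le_rfl hnL,
        dyadicGrid_subset_Ioo (dyadicNode_mem_dyadicGrid hnL hn c.2)⟩
      ⟨dyadicNode_mem_Icc hnm hm,
        dyadicGrid_subset_Ioo (dyadicNode_mem_dyadicGrid hm (by omega) c.2)⟩ using 2
    push_cast
    rw [← sub_div, add_sub_cancel_left, one_div_pow]
  calc ∑ c : Fin (2 ^ L), (g (dyadicNode L m c) - g (dyadicNode L n c)) ^ 2
      ≤ ∑ c : Fin (2 ^ L), (1 / 2) ^ n * energy (c / 2 ^ (L - n)) :=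
        Finset.sum_le_sum fun c _ => cell_bound c
    _ = (1 / 2) ^ n * (2 ^ (L - n) * ∫ x in Ioo (0 : ℝ) 1, g' x ^ 2) := by
        rw [← Finset.mul_sum, sum_fin_comp_div hnL,
          sum_setIntegral_Ioc_div_eq h.memLp_deriv.integrable_sq (by positivity)]
    _ = 2 ^ L * ((1 / 2) ^ n) ^ 2 * ∫ x in Ioo (0 : ℝ) 1, g' x ^ 2 := by
        rw [pow_sub₀ _ two_ne_zero hnL, one_div_pow]
        ring

end DyadicNodes

section LevelMatrix

open Matrix

variable {L : ℕ}

/-- The matrix that sends the values of a function on the grid of level `L` to the values at the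
nodes of level `l` attached to the cells of level `L`. There are no nodes of level `0`, where the
matrix is zero. -/
def levelMatrix (L l : ℕ) : Matrix (Fin (2 ^ L)) (dyadicGrid L) ℝ :=
  of fun c y => if l ≠ 0 ∧ dyadicNode L l c = y then 1 else 0

theorem levelMatrix_zero : levelMatrix L 0 = 0 := by
  ext c y
  simp [levelMatrix]

theorem piKronecker_levelMatrix_mulVec {J : Type*} [Fintype J] [DecidableEq J] {l : J → ℕ}
    (hl : ∀ j, l j ≤ L) (f : (J → ℝ) → ℝ) (c : J → Fin (2 ^ L)) :
    (piKronecker (fun j => levelMatrix L (l j)) *ᵥ fun y => f fun j => y j) c =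
      if ∀ j, l j ≠ 0 then f fun j => dyadicNode L (l j) (c j) else 0 := by
  simp only [mulVec, dotProduct, piKronecker_apply, levelMatrix, of_apply, Fintype.prod_ite_zero,
    Finset.prod_const_one, ite_mul, one_mul, zero_mul]
  split_ifs with hl0
  · set node : J → dyadicGrid L := fun j => ⟨dyadicNode L (l j) (c j),
      dyadicGrid_mono (hl j) (dyadicNode_mem_dyadicGrid (hl j) (hl0 j) (c j).2)⟩
    rw [Fintype.sum_eq_single node]
    · simp [node, hl0]
    · intro y hy
      refine if_neg fun h => hy ?_
      ext j
      exact (h j).2.symm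
  · refine Finset.sum_eq_zero fun y _ => if_neg fun h => hl0 fun j => (h j).1

theorem levelMatrix_mulVec {l : ℕ} (hl : l ≤ L) (g : ℝ → ℝ) (c : Fin (2 ^ L)) :
    (levelMatrix L l *ᵥ fun y => g y) c = if l ≠ 0 then g (dyadicNode L l c) else 0 := by
  simp only [mulVec, dotProduct, levelMatrix, of_apply, ite_mul, one_mul, zero_mul]
  split_ifs with hl0
  · rw [Fintype.sum_eq_single ⟨dyadicNode L l c,
      dyadicGrid_mono hl (dyadicNode_mem_dyadicGrid hl hl0 c.2)⟩]
    · simp [hl0]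
    · intro y hy
      exact if_neg fun h => hy (Subtype.ext h.2.symm)
  · exact Finset.sum_eq_zero fun y _ => if_neg fun h => hl0 h.1

theorem IsH1.sum_levelMatrix_sub_mulVec_sq_le {g g' : ℝ → ℝ} (h : IsH1 g g')
    (hg : ContinuousOn g (Ioo 0 1)) {B : ℝ} (hB : ∀ x ∈ Ioo (0 : ℝ) 1, |g x| ≤ B)
    (hB' : ∫ x in Ioo (0 : ℝ) 1, g' x ^ 2 ≤ B ^ 2) {n m : ℕ} (hnm : n ≤ m) (hm : m ≤ L) :
    ∑ c, ((levelMatrix L m - levelMatrix L n) *ᵥ fun y => g y) c ^ 2 ≤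
      2 ^ L * ((1 / 2) ^ n * B) ^ 2 := by
  simp only [sub_mulVec, Pi.sub_apply, levelMatrix_mulVec hm, levelMatrix_mulVec (hnm.trans hm)]
  rcases eq_or_ne n 0 with rfl | hn
  · have term_le (c : Fin (2 ^ L)) : (if m ≠ 0 then g (dyadicNode L m c) else 0) ^ 2 ≤ B ^ 2 := by
      split_ifs with hm0
      · have node_mem := dyadicGrid_subset_Ioo (dyadicNode_mem_dyadicGrid hm hm0 c.2)
        exact sq_le_sq.2 ((hB _ node_mem).trans (le_abs_self B))
      · simpa using sq_nonneg B
    simpa using Finset.sum_le_sum fun c (_ : c ∈ Finset.univ) => term_le c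
  · have hm0 : m ≠ 0 := by omega
    simp only [hn, hm0, ne_eq, not_false_eq_true, if_true]
    calc ∑ c : Fin (2 ^ L), (g (dyadicNode L m c) - g (dyadicNode L n c)) ^ 2
        ≤ 2 ^ L * ((1 / 2) ^ n) ^ 2 * ∫ x in Ioo (0 : ℝ) 1, g' x ^ 2 :=
          h.sum_dyadicNode_sub_sq_le hg hn hnm hm
      _ ≤ 2 ^ L * ((1 / 2) ^ n) ^ 2 * B ^ 2 := by gcongr
      _ = 2 ^ L * ((1 / 2) ^ n * B) ^ 2 := by ring

end LevelMatrix

section KernelSection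

variable {E : Type*} {I : Set E} (K : Matrix I I (ℝ →L[ℝ] ℝ)) [Fact K.PosSemidef]

open scoped Classical in
/-- The function `k(·, x)`, as an element of the reproducing kernel Hilbert space of `k`. It is
extended by `0` to the points `x` outside the domain of the kernel. -/
def kernelSection (x : E) : RKHS.OfKernel K :=
  if hx : x ∈ I then RKHS.kerFun (RKHS.OfKernel K) ⟨x, hx⟩ 1 else 0

theorem inner_kernelSection {x : E} (hx : x ∈ I) (h : RKHS.OfKernel K) :
    inner ℝ (kernelSection K x) h = h ⟨x, hx⟩ := by
  rw [kernelSection, dif_pos hx, RKHS.kerFun_inner]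
  simp

theorem inner_kernelSection_kernelSection {x y : E} (hx : x ∈ I) (hy : y ∈ I) :
    inner ℝ (kernelSection K x) (kernelSection K y) = K ⟨x, hx⟩ ⟨y, hy⟩ 1 := by
  rw [inner_kernelSection K hx, kernelSection, dif_pos hy, RKHS.kerFun_apply,
    RKHS.OfKernel.kernel_ofKernel]

theorem continuousOn_kernelSection [TopologicalSpace E] {k : E → E → ℝ} {S : Set E} (hS : S ⊆ I)
    (hKk : ∀ x y : I, K x y 1 = k x y)
    (hk : ContinuousOn (fun z : E × E => k z.1 z.2) (S ×ˢ S)) :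
    ContinuousOn (kernelSection K) S := by
  intro y hy
  rw [ContinuousWithinAt, tendsto_iff_norm_sub_tendsto_zero]
  have diagonal : Filter.Tendsto (fun x => k x x) (nhdsWithin y S) (nhds (k y y)) :=
    (hk.comp (continuousOn_id.prodMk continuousOn_id) fun x hx => ⟨hx, hx⟩) y hy
  have slice : Filter.Tendsto (fun x => k x y) (nhdsWithin y S) (nhds (k y y)) :=
    (hk.comp (continuousOn_id.prodMk continuousOn_const) fun x hx => ⟨hx, hy⟩) y hy
  have distance := ((diagonal.sub (slice.const_mul 2)).add_const (k y y)).sqrt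
  rw [show k y y - 2 * k y y + k y y = 0 by ring, Real.sqrt_zero] at distance
  refine distance.congr' ?_
  filter_upwards [self_mem_nhdsWithin] with x hx
  rw [← Real.sqrt_sq (norm_nonneg _), norm_sub_sq_real, ← real_inner_self_eq_norm_sq,
    ← real_inner_self_eq_norm_sq, inner_kernelSection_kernelSection K (hS hx) (hS hx),
    inner_kernelSection_kernelSection K (hS hx) (hS hy),
    inner_kernelSection_kernelSection K (hS hy) (hS hy), hKk, hKk, hKk]

theorem restrictNorm_le {X₀ : Set E} {g : E → ℝ} {h : RKHS.OfKernel K}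
    (hh : h ∈ extensions K X₀ g) : restrictNorm K X₀ g ≤ ‖h‖ :=
  csInf_le ⟨0, forall_mem_image.2 fun _ _ => norm_nonneg _⟩ (mem_image_of_mem _ hh)

theorem restrictNorm_nonneg (X₀ : Set E) (g : E → ℝ) : 0 ≤ restrictNorm K X₀ g :=
  Real.sInf_nonneg (forall_mem_image.2 fun _ _ => norm_nonneg _)

theorem MemRestrict.le_mul_restrictNorm_add {X₀ : Set E} {g : E → ℝ} (hg : MemRestrict K X₀ g)
    {a b c : ℝ} (hc : 0 ≤ c) (h : ∀ u ∈ extensions K X₀ g, a ≤ c * ‖u‖ + b) :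
    a ≤ c * restrictNorm K X₀ g + b := by
  have hbdd : BddBelow ((fun u => ‖u‖) '' extensions K X₀ g) :=
    ⟨0, forall_mem_image.2 fun _ _ => norm_nonneg _⟩
  have monotone : Monotone fun t : ℝ => c * t + b := fun s t hst => by dsimp only; gcongr
  rw [restrictNorm, monotone.map_csInf_of_continuousAt (by fun_prop) (hg.image _) hbdd, image_image]
  exact le_csInf (hg.image _) (forall_mem_image.2 h)

theorem inner_kernelSection_mem_extensions (X₀ : Set E) (h : RKHS.OfKernel K) :
    h ∈ extensions K X₀ fun x => inner ℝ (kernelSection K x) h :=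
  fun x _ => (inner_kernelSection K x.2 h).symm

end KernelSection

namespace TMKernel

variable {d : ℕ} (T : TMKernel d)

theorem kernel₁_apply_one (j : Fin d) (x y : T.side j) : T.kernel₁ j x y 1 = T.factor j x y := by
  simp [kernel₁, scalarKernel]

theorem kernel_apply_one (x y : T.box) :
    T.kernel x y 1 = ∏ j, T.factor j (x.1 j) (y.1 j) := by
  simp [kernel, scalarKernel]

theorem inner_kernelSection_eq_prod {x y : Fin d → ℝ} (hx : x ∈ T.box) (hy : y ∈ T.box) :
    inner ℝ (kernelSection T.kernel x) (kernelSection T.kernel y) =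
      ∏ j, inner ℝ (kernelSection (T.kernel₁ j) (x j)) (kernelSection (T.kernel₁ j) (y j)) := by
  rw [inner_kernelSection_kernelSection _ hx hy, kernel_apply_one]
  refine Finset.prod_congr rfl fun j _ => ?_
  rw [inner_kernelSection_kernelSection _ (hx j) (hy j), kernel₁_apply_one]

/-- The part of `TMKernel.Regular` on which the error bound rests: each interval `(a j, b j)`
contains `(0, 1)`, the functions `p j` and `q j` are continuous there, and the restriction to
`(0, 1)` of the reproducing kernel Hilbert space of the factor `k_j` consists of Sobolev functions
whose Dirichlet energy is controlled by their norm. -/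
structure H1Embedded : Prop where
  Ioo_subset_side : ∀ j, Ioo 0 1 ⊆ T.side j
  continuousOn_p : ∀ j, ContinuousOn (T.p j) (Ioo 0 1)
  continuousOn_q : ∀ j, ContinuousOn (T.q j) (Ioo 0 1)
  lower : ∀ j, ∃ c : ℝ, 0 < c ∧ ∀ g : ℝ → ℝ, MemRestrict (T.kernel₁ j) (Ioo 0 1) g →
    ∃ g' : ℝ → ℝ, IsH1 g g' ∧
      c * ∫ x in Ioo (0 : ℝ) 1, g' x ^ 2 ≤ restrictNorm (T.kernel₁ j) (Ioo 0 1) g ^ 2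

variable {T}

theorem Regular.h1Embedded (hT : T.Regular) : T.H1Embedded := by
  have subset_side (j : Fin d) : Ioo 0 1 ⊆ T.side j := fun x hx =>
    ⟨(hT.a_le j).trans_lt (EReal.coe_pos.2 hx.1),
      (EReal.coe_lt_coe_iff.2 hx.2).trans_le (hT.le_b j)⟩
  exact ⟨subset_side, fun j => (hT.continuous_p j).mono (subset_side j),
    fun j => (hT.continuous_q j).mono (subset_side j), hT.lower⟩

namespace H1Embedded

open Matrix

theorem unitCube_subset_box (hT : T.H1Embedded) : unitCube d ⊆ T.box :=
  fun _ hx j => hT.Ioo_subset_side j (hx j)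

theorem continuousOn_factor (hT : T.H1Embedded) (j : Fin d) :
    ContinuousOn (fun z : ℝ × ℝ => T.factor j z.1 z.2) (Ioo 0 1 ×ˢ Ioo 0 1) := by
  refine ContinuousOn.mul
    ((hT.continuousOn_p j).comp (continuous_fst.min continuous_snd).continuousOn ?_)
    ((hT.continuousOn_q j).comp (continuous_fst.max continuous_snd).continuousOn ?_)
  · rintro ⟨x, y⟩ ⟨hx, hy⟩
    rcases min_choice x y with h | h <;> simp only [h] <;> assumption
  · rintro ⟨x, y⟩ ⟨hx, hy⟩
    rcases max_choice x y with h | h <;> simp only [h] <;> assumption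

theorem continuousOn_kernelSection₁ (hT : T.H1Embedded) (j : Fin d) :
    ContinuousOn (kernelSection (T.kernel₁ j)) (Ioo 0 1) :=
  SparseGrid.continuousOn_kernelSection _ (hT.Ioo_subset_side j) (T.kernel₁_apply_one j)
    (hT.continuousOn_factor j)

theorem continuousOn_kernelSection (hT : T.H1Embedded) :
    ContinuousOn (kernelSection T.kernel) (unitCube d) := by
  refine SparseGrid.continuousOn_kernelSection (k := fun x y => ∏ j, T.factor j (x j) (y j)) _
    hT.unitCube_subset_box T.kernel_apply_one (continuousOn_finsetProd _ fun j _ => ?_)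
  exact (hT.continuousOn_factor j).comp (f := fun z : (Fin d → ℝ) × (Fin d → ℝ) => (z.1 j, z.2 j))
    (by fun_prop) fun z hz => ⟨hz.1 j, hz.2 j⟩

theorem exists_isH1_inner_kernelSection (hT : T.H1Embedded) (j : Fin d) :
    ∃ B : ℝ, 0 ≤ B ∧ ∀ h : RKHS.OfKernel (T.kernel₁ j), ∃ g' : ℝ → ℝ,
      IsH1 (fun x => inner ℝ (kernelSection (T.kernel₁ j) x) h) g' ∧
        ∫ x in Ioo (0 : ℝ) 1, g' x ^ 2 ≤ (B * ‖h‖) ^ 2 := by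
  obtain ⟨c, hc, lower⟩ := hT.lower j
  refine ⟨√(1 / c), Real.sqrt_nonneg _, fun h => ?_⟩
  have h_extends := inner_kernelSection_mem_extensions (T.kernel₁ j) (Ioo 0 1) h
  obtain ⟨g', hg', energy_le⟩ := lower _ ⟨h, h_extends⟩
  refine ⟨g', hg', ?_⟩
  rw [mul_pow, Real.sq_sqrt (by positivity), one_div_mul_eq_div, le_div_iff₀' hc]
  exact energy_le.trans
    (pow_le_pow_left₀ (restrictNorm_nonneg _ _ _) (restrictNorm_le _ h_extends) 2)

theorem exists_sum_levelMatrix_sub_mulVec_sq_le (hT : T.H1Embedded) (j : Fin d) :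
    ∃ B : ℝ, 0 ≤ B ∧ ∀ (h : RKHS.OfKernel (T.kernel₁ j)) {n m L : ℕ}, n ≤ m → m ≤ L →
      ∑ c, ((levelMatrix L m - levelMatrix L n) *ᵥ
          fun y => inner ℝ (kernelSection (T.kernel₁ j) y) h) c ^ 2 ≤
        2 ^ L * ((1 / 2) ^ n * B) ^ 2 * ‖h‖ ^ 2 := by
  obtain ⟨B, hB, embedding⟩ := hT.exists_isH1_inner_kernelSection j
  set e := kernelSection (T.kernel₁ j)
  refine ⟨‖e (1 / 2)‖ + B, by positivity, fun h n m L hnm hm => ?_⟩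
  obtain ⟨g', isH1, energy_le⟩ := embedding h
  have continuous : ContinuousOn (fun x => inner ℝ (e x) h) (Ioo 0 1) :=
    (hT.continuousOn_kernelSection₁ j).inner continuousOn_const
  have abs_le (x : ℝ) (hx : x ∈ Ioo (0 : ℝ) 1) : |inner ℝ (e x) h| ≤ (‖e (1 / 2)‖ + B) * ‖h‖ := by
    rw [add_mul]
    exact (isH1.abs_le_abs_add continuous (by positivity) energy_le (by norm_num) hx).trans
      (add_le_add_left (abs_real_inner_le_norm _ _) _)
  refine (isH1.sum_levelMatrix_sub_mulVec_sq_le continuous abs_le (energy_le.trans ?_) hnm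
    hm).trans (le_of_eq (by ring))
  gcongr
  exact le_add_of_nonneg_left (norm_nonneg _)

end H1Embedded

end TMKernel

section SparseGridSampling

open scoped Matrix

variable {d D L τ : ℕ}

theorem sum_comp_le_of_card_fiber_le {α β : Type*} [Fintype α] [DecidableEq β] {s : Finset β}
    {p : α → β} (hp : ∀ a, p a ∈ s) {M : ℝ}
    (hM : ∀ y ∈ s, ((Finset.univ.filter fun a => p a = y).card : ℝ) ≤ M) {ψ : β → ℝ}
    (hψ : ∀ y ∈ s, 0 ≤ ψ y) : ∑ a, ψ (p a) ≤ M * ∑ y ∈ s, ψ y := by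
  rw [← Finset.sum_fiberwise_of_maps_to (t := s) fun a _ => hp a, Finset.mul_sum]
  refine Finset.sum_le_sum fun y hy => ?_
  calc ∑ a with p a = y, ψ (p a) = (Finset.univ.filter fun a => p a = y).card * ψ y := by
        rw [← nsmul_eq_mul, ← Finset.sum_const]
        exact Finset.sum_congr rfl fun a ha => by rw [(Finset.mem_filter.1 ha).2]
    _ ≤ M * ψ y := mul_le_mul_of_nonneg_right (hM y hy) (hψ y hy)

theorem piFinset_dyadicGrid_subset_sparseGrid {l : Fin d → ℕ} (hl0 : ∀ j, l j ≠ 0)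
    (hl : ∑ j, l j ≤ τ + d - 1) :
    (Fintype.piFinset fun j => dyadicGrid (l j)) ⊆ sparseGrid d τ := by
  classical
  refine Finset.subset_biUnion_of_mem (fun l : Fin d → ℕ =>
    Fintype.piFinset fun j => dyadicGrid (l j)) (Finset.mem_filter.2 ⟨?_, hl⟩)
  exact Fintype.mem_piFinset.2 fun j => Finset.mem_Icc.2 ⟨Nat.one_le_iff_ne_zero.2 (hl0 j),
    (Finset.single_le_sum (fun _ _ => Nat.zero_le _) (Finset.mem_univ j)).trans hl⟩

theorem card_filter_forall_dyadicNode_eq_le {l : Fin d → ℕ} (hl : ∀ j, l j ≤ L)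
    (y : Fin d → ℝ) :
    ((Finset.univ.filter fun c : Fin d → Fin (2 ^ L) =>
      (fun j => dyadicNode L (l j) (c j)) = y).card : ℝ) ≤
      (2 ^ L) ^ d * (2 ^ d * (1 / 2) ^ ∑ j, l j) := by
  classical
  have fiber_eq : (Finset.univ.filter fun c : Fin d → Fin (2 ^ L) =>
      (fun j => dyadicNode L (l j) (c j)) = y) = Fintype.piFinset fun j =>
        Finset.univ.filter fun c : Fin (2 ^ L) => dyadicNode L (l j) c = y j := by
    ext c
    simp [funext_iff]
  calc ((Finset.univ.filter fun c : Fin d → Fin (2 ^ L) =>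
        (fun j => dyadicNode L (l j) (c j)) = y).card : ℝ)
      ≤ ∏ j, 2 * 2 ^ (L - l j) := by
        rw [fiber_eq, Fintype.card_piFinset]
        exact_mod_cast Finset.prod_le_prod' fun j _ => card_filter_dyadicNode_eq_le (y j)
    _ = ∏ j, 2 ^ L * (2 * (1 / 2) ^ l j) :=
        Finset.prod_congr rfl fun j _ => by
          rw [pow_sub₀ _ two_ne_zero (hl j), one_div_pow]
          ring
    _ = (2 ^ L) ^ d * (2 ^ d * (1 / 2) ^ ∑ j, l j) := by
        simp [Finset.prod_mul_distrib, Finset.prod_pow_eq_pow_sum]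

theorem sum_dyadicNode_sq_le {l : Fin d → ℕ} (hl0 : ∀ j, l j ≠ 0) (hl : ∀ j, l j ≤ L)
    (hτ : τ ≤ ∑ j, l j) (hτ' : ∑ j, l j ≤ τ + d - 1) (f : (Fin d → ℝ) → ℝ) :
    ∑ c : Fin d → Fin (2 ^ L), f (fun j => dyadicNode L (l j) (c j)) ^ 2 ≤
      (2 ^ L) ^ d * (2 ^ d * (1 / 2) ^ τ * ∑ y ∈ sparseGrid d τ, f y ^ 2) := by
  classical
  rw [← mul_assoc]
  refine sum_comp_le_of_card_fiber_le (ψ := fun y => f y ^ 2)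
    (p := fun (c : Fin d → Fin (2 ^ L)) j => dyadicNode L (l j) (c j)) (fun c => ?_)
    (fun y _ => (card_filter_forall_dyadicNode_eq_le hl y).trans ?_) fun y _ => sq_nonneg _
  · exact piFinset_dyadicGrid_subset_sparseGrid hl0 hτ' (Fintype.mem_piFinset.2 fun j =>
      dyadicNode_mem_dyadicGrid (hl j) (hl0 j) (c j).2)
  · gcongr _ * (_ * ?_)
    exact pow_le_pow_of_le_one (by norm_num) (by norm_num) hτ

theorem sum_piKronecker_levelMatrix_mulVec_sq_le {l : Fin d → ℕ} (hl : ∀ j, l j ≤ L)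
    (hτ : τ ≤ ∑ j, l j) (hτ' : ∑ j, l j ≤ τ + d - 1) (f : (Fin d → ℝ) → ℝ) :
    ∑ c, (piKronecker (fun j => levelMatrix L (l j)) *ᵥ fun y => f fun j => y j) c ^ 2 ≤
      (2 ^ L) ^ d * (2 ^ d * (1 / 2) ^ τ * ∑ y ∈ sparseGrid d τ, f y ^ 2) := by
  simp only [piKronecker_levelMatrix_mulVec hl]
  by_cases hl0 : ∀ j, l j ≠ 0
  · simpa only [if_pos hl0] using sum_dyadicNode_sq_le hl0 hl hτ hτ' f
  · simp only [if_neg hl0, ne_eq, OfNat.ofNat_ne_zero, not_false_eq_true, zero_pow,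
      Finset.sum_const_zero]
    positivity

theorem sum_dyadicNode_sq_le_of_approx (f : (Fin (D + 1) → ℝ) → ℝ) {K : ℝ} (hK : 0 ≤ K)
    (hL : L ≠ 0) (hτ : τ ≤ L)
    (approx : ∀ m n : Fin (D + 1) → ℕ, n ≤ m → (∀ j, m j ≤ L) →
      ∑ c, (piKronecker (fun j => levelMatrix L (m j) - levelMatrix L (n j)) *ᵥ
        fun y => f fun j => y j) c ^ 2 ≤ (2 ^ L) ^ (D + 1) * (K * (1 / 2) ^ ∑ j, n j) ^ 2) :
    ∑ c : Fin (D + 1) → Fin (2 ^ L), f (fun j => dyadicNode L L (c j)) ^ 2 ≤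
      (2 ^ L) ^ (D + 1) * (K * ((τ + 2) ^ D * (1 / 2) ^ τ) + τ ^ D * (2 ^ D *
        √(2 ^ (D + 1) * (1 / 2) ^ τ * ∑ y ∈ sparseGrid (D + 1) τ, f y ^ 2))) ^ 2 := by
  set S := piKroneckerMulVec (ι := fun _ : Fin (D + 1) => Fin (2 ^ L))
    fun y : Fin (D + 1) → dyadicGrid L => f fun j => y j
  set N : ℝ := √((2 ^ L) ^ (D + 1))
  have sq_N : N ^ 2 = (2 ^ L) ^ (D + 1) := Real.sq_sqrt (by positivity)
  have norm_sub_le (m n : Fin (D + 1) → ℕ) (hnm : n ≤ m) (hm : ∀ j, m j ≤ L) :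
      ‖S fun j => levelMatrix L (m j) - levelMatrix L (n j)‖ ≤ N * K * (1 / 2) ^ ∑ j, n j := by
    refine le_of_sq_le_sq ?_ (by positivity)
    rw [norm_piKroneckerMulVec_sq, mul_assoc, mul_pow, sq_N]
    exact approx m n hnm hm
  have norm_le (l : Fin (D + 1) → ℕ) (hl : ∀ j, l j ≤ L) (hτl : τ ≤ ∑ j, l j)
      (hlτ : ∑ j, l j ≤ τ + D) : ‖S fun j => levelMatrix L (l j)‖ ≤
        N * √(2 ^ (D + 1) * (1 / 2) ^ τ * ∑ y ∈ sparseGrid (D + 1) τ, f y ^ 2) := by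
    refine le_of_sq_le_sq ?_ (by positivity)
    rw [norm_piKroneckerMulVec_sq, mul_pow, sq_N, Real.sq_sqrt (by positivity)]
    exact sum_piKronecker_levelMatrix_mulVec_sq_le hl hτl hlτ f
  have norm_top_le := norm_map_le_of_approx_of_stable S (fun _ => levelMatrix L)
    (fun _ => levelMatrix_zero) (by positivity) hτ norm_sub_le norm_le
  calc ∑ c : Fin (D + 1) → Fin (2 ^ L), f (fun j => dyadicNode L L (c j)) ^ 2
      = ‖S fun _ => levelMatrix L L‖ ^ 2 := by
        simp [S, norm_piKroneckerMulVec_sq, piKronecker_levelMatrix_mulVec, hL]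
    _ ≤ _ := pow_le_pow_left₀ (norm_nonneg _) norm_top_le 2
    _ = _ := by rw [← sq_N]; ring

end SparseGridSampling

section RKHSSampling

open scoped Matrix

variable {D : ℕ} {T : TMKernel (D + 1)}

theorem TMKernel.H1Embedded.exists_sum_dyadicNode_sq_le (hT : T.H1Embedded) :
    ∃ K : ℝ, 0 ≤ K ∧ ∀ (h : RKHS.OfKernel T.kernel) {L τ : ℕ}, L ≠ 0 → τ ≤ L →
      ∑ c : Fin (D + 1) → Fin (2 ^ L),
          inner ℝ (kernelSection T.kernel fun j => dyadicNode L L (c j)) h ^ 2 ≤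
        (2 ^ L) ^ (D + 1) * (K * ‖h‖ * ((τ + 2) ^ D * (1 / 2) ^ τ) + τ ^ D * (2 ^ D *
          √(2 ^ (D + 1) * (1 / 2) ^ τ *
            ∑ y ∈ sparseGrid (D + 1) τ, inner ℝ (kernelSection T.kernel y) h ^ 2))) ^ 2 := by
  choose B hB factor_bound using hT.exists_sum_levelMatrix_sub_mulVec_sq_le
  have prod_B_nonneg : 0 ≤ ∏ j, B j := Finset.prod_nonneg fun j _ => hB j
  refine ⟨∏ j, B j, prod_B_nonneg, fun h L τ hL hτ => ?_⟩
  refine sum_dyadicNode_sq_le_of_approx (fun x => inner ℝ (kernelSection T.kernel x) h)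
    (by positivity) hL hτ fun m n hnm hm => ?_
  have grid_subset_box (y : Fin (D + 1) → dyadicGrid L) : (fun j => (y j : ℝ)) ∈ T.box :=
    hT.unitCube_subset_box fun j => dyadicGrid_subset_Ioo (y j).2
  refine (sum_piKronecker_mulVec_inner_sq_le (κ := fun _ => dyadicGrid L)
    (fun j y => kernelSection (T.kernel₁ j) y) (fun y => kernelSection T.kernel fun j => y j)
    (fun y z => T.inner_kernelSection_eq_prod (grid_subset_box y) (grid_subset_box z)) _
    (fun j => by positivity)
    (fun j g => factor_bound j g (hnm j) (hm j)) h).trans (le_of_eq ?_)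
  rw [Finset.prod_mul_distrib, Finset.prod_const, Finset.card_univ, Fintype.card_fin,
    Finset.prod_pow, Finset.prod_mul_distrib, Finset.prod_pow_eq_pow_sum]
  ring

end RKHSSampling

section LTwoNorm

theorem eLpNorm_two_comp_le_of_sum_sq_le {X ι : Type*} [MeasurableSpace X] {μ : Measure X}
    [Fintype ι] [MeasurableSpace ι] [MeasurableSingletonClass ι] {P : X → ι} (hP : Measurable P)
    {v r : ℝ} (hv : 0 ≤ v) (hr : 0 ≤ r) (fiber_le : ∀ i, μ (P ⁻¹' {i}) ≤ ENNReal.ofReal v)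
    {G : ι → ℝ} (hG : v * ∑ i, G i ^ 2 ≤ r ^ 2) :
    eLpNorm (fun x => G (P x)) 2 μ ≤ ENNReal.ofReal r := by
  have enorm_sq (t : ℝ) : ‖t‖ₑ ^ (2 : ℝ) = ENNReal.ofReal (t ^ 2) := by
    rw [Real.enorm_eq_ofReal_abs, ENNReal.ofReal_rpow_of_nonneg (abs_nonneg t) two_pos.le,
      Real.rpow_two, sq_abs]
  have lintegral_le : ∫⁻ x, ‖G (P x)‖ₑ ^ (2 : ℝ) ∂μ ≤ ENNReal.ofReal r ^ (2 : ℝ) :=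
    calc ∫⁻ x, ‖G (P x)‖ₑ ^ (2 : ℝ) ∂μ
        = ∑ i, ENNReal.ofReal (G i ^ 2) * μ (P ⁻¹' {i}) := by
          rw [← lintegral_map (f := fun i => ‖G i‖ₑ ^ (2 : ℝ)) (measurable_of_finite _) hP,
            lintegral_fintype]
          simp only [enorm_sq, Measure.map_apply hP (measurableSet_singleton _)]
      _ ≤ ∑ i, ENNReal.ofReal (G i ^ 2) * ENNReal.ofReal v := by
          gcongr with i
          exact fiber_le i
      _ = ENNReal.ofReal (v * ∑ i, G i ^ 2) := by
          rw [← Finset.sum_mul, ← ENNReal.ofReal_sum_of_nonneg fun _ _ => sq_nonneg _, mul_comm,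
            ← ENNReal.ofReal_mul hv]
      _ ≤ ENNReal.ofReal r ^ (2 : ℝ) := by
          rw [ENNReal.ofReal_rpow_of_nonneg hr two_pos.le, Real.rpow_two]
          exact ENNReal.ofReal_le_ofReal hG
  rw [eLpNorm_eq_lintegral_rpow_enorm_toReal two_ne_zero ENNReal.ofNat_ne_top,
    ENNReal.toReal_ofNat, one_div, ENNReal.rpow_inv_le_iff two_pos]
  exact lintegral_le

variable {d L : ℕ}

theorem measurableSet_unitCube : MeasurableSet (unitCube d) := by
  have unitCube_eq_pi : unitCube d = Set.pi univ fun _ => Ioo (0 : ℝ) 1 := by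
    ext x
    simp [unitCube]
  rw [unitCube_eq_pi]
  exact MeasurableSet.univ_pi fun _ => measurableSet_Ioo

/-- The index of the cell `∏ j, [c j / 2 ^ L, (c j + 1) / 2 ^ L)` that contains the point `x` of the
unit cube. Outside the cube the value is reduced modulo `2 ^ L` and has no meaning. -/
def cellIndex (L : ℕ) (x : Fin d → ℝ) : Fin d → Fin (2 ^ L) :=
  fun j => Fin.ofNat (2 ^ L) ⌊2 ^ L * x j⌋₊

theorem measurable_cellIndex : Measurable (cellIndex L : (Fin d → ℝ) → Fin d → Fin (2 ^ L)) :=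
  measurable_pi_lambda _ fun j => (measurable_from_nat (f := Fin.ofNat (2 ^ L))).comp
    (Nat.measurable_floor.comp ((measurable_pi_apply j).const_mul _))

theorem mem_Icc_cellIndex {x : Fin d → ℝ} (hx : x ∈ unitCube d) (j : Fin d) :
    x j ∈ Icc ((cellIndex L x j : ℝ) / 2 ^ L) ((cellIndex L x j + 1) / 2 ^ L) := by
  have floor_lt : ⌊2 ^ L * x j⌋₊ < 2 ^ L := by
    rw [Nat.floor_lt' (by positivity)]
    push_cast
    exact mul_lt_of_lt_one_right (by positivity) (hx j).2
  have cellIndex_eq : ((cellIndex L x j : ℕ) : ℝ) = ⌊2 ^ L * x j⌋₊ := by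
    rw [cellIndex, Fin.val_ofNat, Nat.mod_eq_of_lt floor_lt]
  rw [cellIndex_eq]
  constructor
  · rw [div_le_iff₀' (by positivity)]
    exact Nat.floor_le (mul_nonneg (by positivity) (hx j).1.le)
  · rw [le_div_iff₀' (by positivity)]
    exact (Nat.lt_floor_add_one _).le

theorem volume_preimage_cellIndex_le (c : Fin d → Fin (2 ^ L)) :
    volume.restrict (unitCube d) (cellIndex L ⁻¹' {c}) ≤ ENNReal.ofReal ((1 / 2 ^ L) ^ d) := by
  rw [Measure.restrict_apply (measurable_cellIndex (measurableSet_singleton c))]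
  calc volume (cellIndex L ⁻¹' {c} ∩ unitCube d)
      ≤ volume (Icc (fun j => (c j : ℝ) / 2 ^ L) fun j => ((c j : ℝ) + 1) / 2 ^ L) := by
        refine measure_mono ?_
        rintro x ⟨rfl, hx⟩
        exact ⟨fun j => (mem_Icc_cellIndex hx j).1, fun j => (mem_Icc_cellIndex hx j).2⟩
    _ = ENNReal.ofReal ((1 / 2 ^ L) ^ d) := by
        rw [Real.volume_Icc_pi, ENNReal.ofReal_pow (by positivity)]
        simp only [← sub_div, add_sub_cancel_left, Finset.prod_const, Finset.card_univ,
          Fintype.card_fin]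

theorem tendsto_dyadicNode_cellIndex {x : Fin d → ℝ} (hx : x ∈ unitCube d) :
    Filter.Tendsto (fun L j => dyadicNode L L (cellIndex L x j)) Filter.atTop
      (nhdsWithin x (unitCube d)) := by
  refine tendsto_nhdsWithin_iff.2 ⟨tendsto_pi_nhds.2 fun j => ?_, ?_⟩
  · rw [tendsto_iff_dist_tendsto_zero]
    refine squeeze_zero (fun _ => dist_nonneg) (fun L => ?_)
      (tendsto_pow_atTop_nhds_zero_of_lt_one (r := 1 / 2) (by norm_num) (by norm_num))
    have node_mem := dyadicNode_mem_Icc (c := cellIndex L x j) (le_refl L) le_rfl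
    rw [Nat.sub_self, pow_zero, Nat.div_one] at node_mem
    push_cast at node_mem
    refine (Real.dist_le_of_mem_Icc node_mem (mem_Icc_cellIndex hx j)).trans_eq ?_
    rw [← sub_div, add_sub_cancel_left, one_div_pow]
  · filter_upwards [Filter.eventually_ne_atTop 0] with L hL j
    exact dyadicGrid_subset_Ioo (dyadicNode_mem_dyadicGrid le_rfl hL (cellIndex L x j).2)

theorem eLpNorm_two_unitCube_le_of_sum_dyadicNode_sq_le {f : (Fin d → ℝ) → ℝ}
    (hf : ContinuousOn f (unitCube d)) {r : ℝ} (hr : 0 ≤ r)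
    (hfr : ∀ᶠ L in Filter.atTop,
      ∑ c : Fin d → Fin (2 ^ L), f (fun j => dyadicNode L L (c j)) ^ 2 ≤ (2 ^ L) ^ d * r ^ 2) :
    eLpNorm f 2 (volume.restrict (unitCube d)) ≤ ENNReal.ofReal r := by
  have measurable_sample (L : ℕ) : Measurable fun x : Fin d → ℝ =>
      f fun j => dyadicNode L L (cellIndex L x j) :=
    (measurable_of_finite fun c : Fin d → Fin (2 ^ L) => f fun j => dyadicNode L L (c j)).comp
      measurable_cellIndex
  have tendsto_sample : ∀ᵐ x ∂volume.restrict (unitCube d), Filter.Tendsto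
      (fun L => f fun j => dyadicNode L L (cellIndex L x j)) Filter.atTop (nhds (f x)) := by
    filter_upwards [self_mem_ae_restrict measurableSet_unitCube] with x hx
    exact (hf x hx).tendsto.comp (tendsto_dyadicNode_cellIndex hx)
  refine (Lp.eLpNorm_lim_le_liminf_eLpNorm
    (fun L => (measurable_sample L).aestronglyMeasurable) f tendsto_sample).trans
    (Filter.liminf_le_of_frequently_le' (Filter.Eventually.frequently ?_))
  filter_upwards [hfr] with L hL
  refine eLpNorm_two_comp_le_of_sum_sq_le measurable_cellIndex (v := (1 / 2 ^ L) ^ d)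
    (by positivity) hr volume_preimage_cellIndex_le
    (G := fun c => f fun j => dyadicNode L L (c j)) ?_
  calc _ ≤ (1 / 2 ^ L : ℝ) ^ d * ((2 ^ L) ^ d * r ^ 2) := by gcongr
    _ = r ^ 2 := by
      rw [← mul_assoc, ← mul_pow, one_div_mul_cancel (by positivity), one_pow, one_mul]

end LTwoNorm

section SparseGridCardinality

variable {D τ : ℕ}

theorem card_dyadicGrid (l : ℕ) : (dyadicGrid l).card = 2 ^ l - 1 := by
  have injective : Function.Injective fun i : ℕ => (i : ℝ) / 2 ^ l :=
    fun i j h => Nat.cast_injective ((div_left_inj' (by positivity)).1 h)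
  rw [dyadicGrid, Finset.card_image_of_injective _ injective, Nat.card_Icc, Nat.add_sub_cancel]

theorem card_filter_sum_eq_le {M : Type*} [AddCancelCommMonoid M] [DecidableEq M] (A : Finset M)
    (s : M) :
    ((Fintype.piFinset fun _ : Fin (D + 1) => A).filter fun l => ∑ j, l j = s).card ≤
      A.card ^ D := by
  rw [← Fintype.card_fin D, ← Fintype.card_piFinset_const, Fintype.card_fin]
  refine Finset.card_le_card_of_injOn Fin.tail (fun l hl => ?_) fun l hl l' hl' htail => ?_
  · have mem_A := Fintype.mem_piFinset.1 (Finset.mem_filter.1 hl).1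
    exact Fintype.mem_piFinset.2 fun j => mem_A j.succ
  · have sum_eq : ∑ j, l j = ∑ j, l' j :=
      (Finset.mem_filter.1 hl).2.trans (Finset.mem_filter.1 hl').2.symm
    have tail_eq (j : Fin D) : l j.succ = l' j.succ := congrFun htail j
    simp only [Fin.sum_univ_succ, tail_eq, add_left_inj] at sum_eq
    exact funext (Fin.cases sum_eq tail_eq)

theorem sum_two_pow_sum_le (D N : ℕ) :
    ∑ l ∈ (Fintype.piFinset fun _ : Fin (D + 1) => Finset.Icc 1 N).filter fun l => ∑ j, l j ≤ N,
      2 ^ ∑ j, l j ≤ N ^ D * 2 ^ (N + 1) := by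
  rw [← Finset.sum_fiberwise_of_maps_to (t := Finset.range (N + 1))
    (g := fun l : Fin (D + 1) → ℕ => ∑ j, l j)
    fun l hl => Finset.mem_range.2 (Nat.lt_succ_of_le (Finset.mem_filter.1 hl).2)]
  calc _ ≤ ∑ s ∈ Finset.range (N + 1), N ^ D * 2 ^ s := by
        refine Finset.sum_le_sum fun s _ => ?_
        rw [Finset.sum_congr rfl fun l hl => by rw [(Finset.mem_filter.1 hl).2], Finset.sum_const,
          smul_eq_mul]
        gcongr
        refine (Finset.card_le_card ?_).trans
          ((card_filter_sum_eq_le (D := D) (Finset.Icc 1 N) s).trans_eq (by simp))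
        exact Finset.filter_subset_filter _ (Finset.filter_subset _ _)
    _ ≤ N ^ D * 2 ^ (N + 1) := by
        rw [← Finset.mul_sum]
        gcongr
        exact (Nat.geomSum_lt le_rfl fun s hs => Finset.mem_range.1 hs).le

theorem card_sparseGrid_le (D τ : ℕ) :
    (sparseGrid (D + 1) τ).card ≤ (τ + D) ^ D * 2 ^ (τ + D + 1) := by
  classical
  refine Finset.card_biUnion_le.trans (le_trans (Finset.sum_le_sum fun l _ => ?_)
    (sum_two_pow_sum_le D (τ + D)))
  rw [Fintype.card_piFinset, ← Finset.prod_pow_eq_pow_sum]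
  exact Finset.prod_le_prod' fun j _ => (card_dyadicGrid _).trans_le (Nat.sub_le _ _)

theorem card_sparseGrid_succ_le (hτ : 1 ≤ τ) :
    (sparseGrid (D + 1) (τ + 1)).card ≤ (D + 2) ^ D * 2 ^ (D + 2) * (τ ^ D * 2 ^ τ) := by
  have base_le : τ + 1 + D ≤ (D + 2) * τ := by nlinarith
  calc (sparseGrid (D + 1) (τ + 1)).card ≤ (τ + 1 + D) ^ D * 2 ^ (τ + 1 + D + 1) :=
        card_sparseGrid_le D (τ + 1)
    _ ≤ ((D + 2) * τ) ^ D * 2 ^ (τ + 1 + D + 1) := by gcongr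
    _ = (D + 2) ^ D * 2 ^ (D + 2) * (τ ^ D * 2 ^ τ) := by rw [mul_pow]; ring

theorem two_pow_sub_one_le_card_sparseGrid (D : ℕ) {τ : ℕ} (hτ : 1 ≤ τ) :
    2 ^ τ - 1 ≤ (sparseGrid (D + 1) τ).card := by
  set l : Fin (D + 1) → ℕ := Fin.cons τ fun _ => 1 with hl
  calc 2 ^ τ - 1 = (Fintype.piFinset fun j => dyadicGrid (l j)).card := by
        simp [hl, Fin.prod_univ_succ, card_dyadicGrid]
    _ ≤ (sparseGrid (D + 1) τ).card := by
        refine Finset.card_le_card (piFinset_dyadicGrid_subset_sparseGrid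
          (Fin.cases (Nat.one_le_iff_ne_zero.1 hτ) fun _ => one_ne_zero) (le_of_eq ?_))
        simp [hl, Fin.sum_univ_succ]

theorem natCast_le_mul_log {n : ℕ} (hn : 2 ≤ n) (h : 2 ^ τ - 1 ≤ n) :
    (τ : ℝ) ≤ 2 / Real.log 2 * Real.log n := by
  have two_pow_le : 2 ^ τ ≤ n ^ 2 := by
    have : n + 1 ≤ n ^ 2 := by nlinarith
    omega
  have log_le : Real.log (2 ^ τ) ≤ Real.log ((n : ℝ) ^ 2) :=
    Real.log_le_log (by positivity) (by exact_mod_cast two_pow_le)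
  rw [Real.log_pow, Real.log_pow] at log_le
  rw [div_mul_eq_mul_div, le_div_iff₀ (Real.log_pos one_lt_two)]
  exact_mod_cast log_le

end SparseGridCardinality

section Rates

theorem approximation_rate_le (D : ℕ) {τ : ℕ} {a K ℓ ν : ℝ} (hτ : 1 ≤ τ) (hν : 0 < ν)
    (hτℓ : τ ≤ a * ℓ) (hντ : ν ≤ K * (τ ^ D * 2 ^ τ)) :
    ((τ : ℝ) + 2) ^ D * (1 / 2) ^ τ ≤ 3 ^ D * K * a ^ (2 * D) * (ν⁻¹ * ℓ ^ (2 * D)) := by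
  have one_le_τ : (1 : ℝ) ≤ τ := by exact_mod_cast hτ
  have hK : 0 < K := (pos_iff_pos_of_mul_pos (hν.trans_le hντ)).2 (by positivity)
  have half_pow_le : (1 / 2 : ℝ) ^ τ ≤ K * τ ^ D * ν⁻¹ := by
    rw [one_div_pow, ← div_eq_mul_inv, div_le_div_iff₀ (by positivity) hν]
    linarith
  calc ((τ : ℝ) + 2) ^ D * (1 / 2) ^ τ ≤ (3 * τ) ^ D * (K * τ ^ D * ν⁻¹) := by
        gcongr
        linarith
    _ = 3 ^ D * K * ν⁻¹ * (τ : ℝ) ^ (2 * D) := by rw [mul_pow, pow_mul', sq]; ring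
    _ ≤ 3 ^ D * K * ν⁻¹ * (a * ℓ) ^ (2 * D) := by gcongr
    _ = 3 ^ D * K * a ^ (2 * D) * (ν⁻¹ * ℓ ^ (2 * D)) := by rw [mul_pow]; ring

theorem stability_rate_le (D : ℕ) {τ : ℕ} {a K ℓ ν N Q : ℝ} (hK : 0 ≤ K) (hℓ : 0 ≤ ℓ) (hN : 0 ≤ N)
    (hτℓ : τ ≤ a * ℓ) (hντ : ν ≤ K * (τ ^ D * 2 ^ τ)) (hQ : Q ≤ ν * N ^ 2) :
    (τ : ℝ) ^ D * (2 ^ D * √(2 ^ (D + 1) * (1 / 2) ^ τ * Q)) ≤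
      2 ^ D * √(2 ^ (D + 1) * K * a ^ (3 * D)) * (√(ℓ ^ (3 * D)) * N) := by
  have Q_le : (1 / 2 : ℝ) ^ τ * Q ≤ K * τ ^ D * N ^ 2 :=
    calc (1 / 2 : ℝ) ^ τ * Q ≤ (1 / 2) ^ τ * (K * (τ ^ D * 2 ^ τ) * N ^ 2) := by
          gcongr
          exact hQ.trans (by gcongr)
      _ = (1 / 2 * 2) ^ τ * (K * τ ^ D * N ^ 2) := by rw [mul_pow]; ring
      _ = K * τ ^ D * N ^ 2 := by norm_num
  calc (τ : ℝ) ^ D * (2 ^ D * √(2 ^ (D + 1) * (1 / 2) ^ τ * Q))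
      = 2 ^ D * √((τ ^ D) ^ 2 * (2 ^ (D + 1) * ((1 / 2) ^ τ * Q))) := by
        rw [mul_assoc (2 ^ (D + 1)), Real.sqrt_mul (sq_nonneg _), Real.sqrt_sq (by positivity)]
        ring
    _ ≤ 2 ^ D * √((τ ^ D) ^ 2 * (2 ^ (D + 1) * (K * τ ^ D * N ^ 2))) := by gcongr
    _ = 2 ^ D * √(2 ^ (D + 1) * K * τ ^ (3 * D) * N ^ 2) := by
        congr 2
        ring
    _ ≤ 2 ^ D * √(2 ^ (D + 1) * K * (a * ℓ) ^ (3 * D) * N ^ 2) := by gcongr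
    _ = 2 ^ D * √(2 ^ (D + 1) * K * a ^ (3 * D)) * (√(ℓ ^ (3 * D)) * N) := by
        rw [mul_pow, ← mul_assoc (2 ^ (D + 1) * K), Real.sqrt_mul' _ (sq_nonneg N),
          Real.sqrt_mul' _ (pow_nonneg hℓ _), Real.sqrt_sq hN]
        ring

theorem rpow_mul_sub_one {x : ℝ} (k D : ℕ) : x ^ ((k : ℝ) * ((D + 1 : ℕ) - 1)) = x ^ (k * D) := by
  rw [← Real.rpow_natCast]
  push_cast
  ring_nf

theorem rpow_mul_sub_one_div_two {x : ℝ} (hx : 0 ≤ x) (k D : ℕ) :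
    x ^ ((k : ℝ) * ((D + 1 : ℕ) - 1) / 2) = √(x ^ (k * D)) := by
  rw [Real.sqrt_eq_rpow, ← Real.rpow_natCast, ← Real.rpow_mul hx]
  push_cast
  ring_nf

end Rates

section Design

variable {d n : ℕ} {x : Fin n → Fin d → ℝ} {s : Finset (Fin d → ℝ)}

theorem card_le_of_subset_range (hs : ↑s ⊆ range x) : s.card ≤ n := by
  classical
  rw [← image_univ, ← Finset.coe_univ, ← Finset.coe_image, Finset.coe_subset] at hs
  exact (Finset.card_le_card hs).trans (Finset.card_image_le.trans_eq (Finset.card_fin n))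

theorem mul_empiricalNorm_sq (f : (Fin d → ℝ) → ℝ) :
    n * empiricalNorm x f ^ 2 = ∑ i, f (x i) ^ 2 := by
  rcases eq_or_ne n 0 with rfl | hn
  · simp
  · rw [empiricalNorm, Real.sq_sqrt (by positivity), ← mul_assoc,
      mul_one_div_cancel (Nat.cast_ne_zero.2 hn), one_mul]

theorem sum_sq_le_mul_empiricalNorm_sq (hs : ↑s ⊆ range x) (f : (Fin d → ℝ) → ℝ) :
    ∑ y ∈ s, f y ^ 2 ≤ n * empiricalNorm x f ^ 2 := by
  classical
  rw [← image_univ, ← Finset.coe_univ, ← Finset.coe_image, Finset.coe_subset] at hs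
  rw [mul_empiricalNorm_sq]
  exact (Finset.sum_le_sum_of_subset_of_nonneg hs fun _ _ _ => sq_nonneg _).trans
    (Finset.sum_image_le_of_nonneg fun _ _ => sq_nonneg _)

theorem sparseGrid_subset_unitCube (d τ : ℕ) : ↑(sparseGrid d τ) ⊆ unitCube d := by
  intro y hy
  obtain ⟨l, -, hy⟩ := Finset.mem_biUnion.1 (Finset.mem_coe.1 hy)
  exact fun j => dyadicGrid_subset_Ioo (Fintype.mem_piFinset.1 hy j)

theorem FormTruncatedSparseGrid.exists_sparseGrid_subset_range (hx : FormTruncatedSparseGrid x) :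
    ∃ τ : ℕ, 1 ≤ τ ∧ n < (sparseGrid d (τ + 1)).card ∧ ↑(sparseGrid d τ) ⊆ range x := by
  classical
  obtain ⟨τ, hτ, -, card_gt, A, -, -, image_eq⟩ := hx
  refine ⟨τ, hτ, card_gt, ?_⟩
  rw [← image_univ, ← Finset.coe_univ, ← Finset.coe_image, Finset.coe_subset]
  exact Finset.subset_union_left.trans_eq (by convert image_eq.symm)

end Design

section ErrorBound

theorem eq_inner_kernelSection {E : Type*} {I X₀ : Set E} {K : Matrix I I (ℝ →L[ℝ] ℝ)}
    [Fact K.PosSemidef] {g : E → ℝ} {h : RKHS.OfKernel K} (hh : h ∈ extensions K X₀ g)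
    (hX₀ : X₀ ⊆ I) {x : E} (hx : x ∈ X₀) : g x = inner ℝ (kernelSection K x) h := by
  rw [inner_kernelSection K (hX₀ hx)]
  exact (hh ⟨x, hX₀ hx⟩ hx).symm

namespace TMKernel.H1Embedded

theorem continuousOn_of_mem {d : ℕ} {T : TMKernel d} (hT : T.H1Embedded) {f : (Fin d → ℝ) → ℝ}
    (hf : T.Mem f) : ContinuousOn f (unitCube d) := by
  obtain ⟨h, hh⟩ := hf
  exact (hT.continuousOn_kernelSection.inner continuousOn_const).congr
    fun x hx => eq_inner_kernelSection hh hT.unitCube_subset_box hx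

variable {D : ℕ} {T : TMKernel (D + 1)}

theorem exists_eLpNorm_le_norm (hT : T.H1Embedded) :
    ∃ K : ℝ, 0 ≤ K ∧ ∀ {f : (Fin (D + 1) → ℝ) → ℝ},
      ∀ h ∈ extensions T.kernel (unitCube (D + 1)) f, ∀ τ : ℕ,
        eLpNorm f 2 (volume.restrict (unitCube (D + 1))) ≤
          ENNReal.ofReal (K * ((τ + 2) ^ D * (1 / 2) ^ τ) * ‖h‖ + τ ^ D * (2 ^ D *
            √(2 ^ (D + 1) * (1 / 2) ^ τ * ∑ y ∈ sparseGrid (D + 1) τ, f y ^ 2))) := by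
  obtain ⟨K, hK, sampling⟩ := hT.exists_sum_dyadicNode_sq_le
  refine ⟨K, hK, fun {f} h hh τ => eLpNorm_two_unitCube_le_of_sum_dyadicNode_sq_le
    (hT.continuousOn_of_mem ⟨h, hh⟩) (by positivity) ?_⟩
  have eq_inner {x : Fin (D + 1) → ℝ} (hx : x ∈ unitCube (D + 1)) :
      f x = inner ℝ (kernelSection T.kernel x) h :=
    eq_inner_kernelSection hh hT.unitCube_subset_box hx
  have grid_sum_eq : ∑ y ∈ sparseGrid (D + 1) τ, f y ^ 2 =
      ∑ y ∈ sparseGrid (D + 1) τ, inner ℝ (kernelSection T.kernel y) h ^ 2 :=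
    Finset.sum_congr rfl fun y hy => by rw [eq_inner (sparseGrid_subset_unitCube _ τ hy)]
  filter_upwards [Filter.eventually_ne_atTop 0, Filter.eventually_ge_atTop τ] with L hL hτ
  have node_mem (c : Fin (D + 1) → Fin (2 ^ L)) :
      (fun j => dyadicNode L L (c j)) ∈ unitCube (D + 1) :=
    fun j => dyadicGrid_subset_Ioo (dyadicNode_mem_dyadicGrid le_rfl hL (c j).2)
  simp only [eq_inner (node_mem _), grid_sum_eq]
  rw [mul_right_comm]
  exact sampling h hL hτ

theorem exists_memLp_and_eLpNorm_le (hT : T.H1Embedded) :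
    ∃ K : ℝ, 0 ≤ K ∧ ∀ {f : (Fin (D + 1) → ℝ) → ℝ}, T.Mem f →
      MemLp f 2 (volume.restrict (unitCube (D + 1))) ∧ ∀ τ : ℕ,
        (eLpNorm f 2 (volume.restrict (unitCube (D + 1)))).toReal ≤
          K * ((τ + 2) ^ D * (1 / 2) ^ τ) * T.norm f + τ ^ D * (2 ^ D *
            √(2 ^ (D + 1) * (1 / 2) ^ τ * ∑ y ∈ sparseGrid (D + 1) τ, f y ^ 2)) := by
  obtain ⟨K, hK, bound⟩ := hT.exists_eLpNorm_le_norm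
  refine ⟨K, hK, fun {f} hf => ⟨⟨?_, ?_⟩, fun τ => ?_⟩⟩
  · exact (hT.continuousOn_of_mem hf).aestronglyMeasurable measurableSet_unitCube
  · obtain ⟨h, hh⟩ := hf
    exact (bound h hh 0).trans_lt ENNReal.ofReal_lt_top
  · exact hf.le_mul_restrictNorm_add T.kernel (by positivity)
      fun h hh => ENNReal.toReal_le_of_le_ofReal (by positivity) (bound h hh τ)

theorem exists_bound (hT : T.H1Embedded) :
    ∃ A B : ℝ, 0 ≤ A ∧ 0 ≤ B ∧ ∀ {n τ : ℕ}, 2 ≤ n → 1 ≤ τ → n < (sparseGrid (D + 1) (τ + 1)).card →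
      ∀ {x : Fin n → Fin (D + 1) → ℝ}, ↑(sparseGrid (D + 1) τ) ⊆ range x →
      ∀ {f : (Fin (D + 1) → ℝ) → ℝ}, T.Mem f →
        MemLp f 2 (volume.restrict (unitCube (D + 1))) ∧
        (eLpNorm f 2 (volume.restrict (unitCube (D + 1)))).toReal ≤
          A * ((n : ℝ)⁻¹ * Real.log n ^ (2 * D) * T.norm f) +
            B * (√(Real.log n ^ (3 * D)) * empiricalNorm x f) := by
  obtain ⟨K, hK, bound⟩ := hT.exists_memLp_and_eLpNorm_le
  set κ : ℝ := (D + 2) ^ D * 2 ^ (D + 2)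
  set a : ℝ := 2 / Real.log 2
  have : 0 < a := div_pos two_pos (Real.log_pos one_lt_two)
  refine ⟨K * (3 ^ D * κ * a ^ (2 * D)), 2 ^ D * √(2 ^ (D + 1) * κ * a ^ (3 * D)), by positivity,
    by positivity, fun {n τ} hn hτ card_gt x hx f hf => ⟨(bound hf).1, ?_⟩⟩
  have τ_le : (τ : ℝ) ≤ a * Real.log n := natCast_le_mul_log hn
    ((two_pow_sub_one_le_card_sparseGrid D hτ).trans (card_le_of_subset_range hx))
  have n_le : (n : ℝ) ≤ κ * (τ ^ D * 2 ^ τ) := by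
    simp only [κ]
    exact_mod_cast card_gt.le.trans (card_sparseGrid_succ_le hτ)
  refine ((bound hf).2 τ).trans (add_le_add ?_ ?_)
  · calc K * ((τ + 2) ^ D * (1 / 2) ^ τ) * T.norm f
        ≤ K * (3 ^ D * κ * a ^ (2 * D) * ((n : ℝ)⁻¹ * Real.log n ^ (2 * D))) * T.norm f :=
          mul_le_mul_of_nonneg_right (mul_le_mul_of_nonneg_left
            (approximation_rate_le D hτ (by positivity) τ_le n_le) hK) (restrictNorm_nonneg _ _ _)
      _ = K * (3 ^ D * κ * a ^ (2 * D)) * ((n : ℝ)⁻¹ * Real.log n ^ (2 * D) * T.norm f) := by ring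
  · exact stability_rate_le D (by positivity) (Real.log_natCast_nonneg n) (Real.sqrt_nonneg _)
      τ_le n_le (sum_sq_le_mul_empiricalNorm_sq hx f)

end TMKernel.H1Embedded

end ErrorBound

end SparseGrid

end

theorem mainTheorem9_general (d : ℕ) (hd : 1 ≤ d) (T : SparseGrid.TMKernel d) (hT : T.H1Embedded) :
    ∃ C : ℝ, 0 < C ∧
      ∀ n : ℕ, 2 ≤ n →
      ∀ τ : ℕ, 1 ≤ τ → n < (SparseGrid.sparseGrid d (τ + 1)).card →
      ∀ x : Fin n → Fin d → ℝ, ↑(SparseGrid.sparseGrid d τ) ⊆ range x →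
      ∀ f : (Fin d → ℝ) → ℝ, T.Mem f →
        MemLp f 2 (volume.restrict (SparseGrid.unitCube d)) ∧
        (eLpNorm f 2 (volume.restrict (SparseGrid.unitCube d))).toReal ≤
          C * (Real.log n ^ (3 * ((d : ℝ) - 1) / 2) * SparseGrid.empiricalNorm x f +
            (n : ℝ)⁻¹ * Real.log n ^ (2 * ((d : ℝ) - 1)) * T.norm f) := by
  obtain ⟨D, rfl⟩ := Nat.exists_eq_add_of_le' hd
  obtain ⟨A, B, hA, hB, bound⟩ := hT.exists_bound
  refine ⟨A + B + 1, by positivity, fun n hn τ hτ card_gt x hx f hf => ?_⟩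
  obtain ⟨memLp, eLpNorm_le⟩ := bound hn hτ card_gt hx hf
  refine ⟨memLp, eLpNorm_le.trans ?_⟩
  have log_nonneg := Real.log_natCast_nonneg n
  have norm_nonneg : 0 ≤ T.norm f := SparseGrid.restrictNorm_nonneg _ _ _
  have empiricalNorm_nonneg : 0 ≤ SparseGrid.empiricalNorm x f := Real.sqrt_nonneg _
  have rpow_three := SparseGrid.rpow_mul_sub_one_div_two log_nonneg 3 D
  have rpow_two := SparseGrid.rpow_mul_sub_one (x := Real.log n) 2 D
  rw [Nat.cast_ofNat] at rpow_three rpow_two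
  rw [rpow_three, rpow_two, add_comm (√_ * _), mul_add]
  gcongr <;> linarith

theorem mainTheorem9 (d : ℕ) (hd : 1 ≤ d) (T : SparseGrid.TMKernel d) (hT : T.Regular) :
    ∃ C : ℝ, 0 < C ∧
      ∀ n : ℕ, 2 ≤ n →
      ∀ x : Fin n → Fin d → ℝ,
        SparseGrid.FormTruncatedSparseGrid x →
      ∀ f : (Fin d → ℝ) → ℝ, T.Mem f →
        MemLp f 2 (volume.restrict (SparseGrid.unitCube d)) ∧
        (eLpNorm f 2 (volume.restrict (SparseGrid.unitCube d))).toReal ≤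
          C * (Real.log n ^ (3 * ((d : ℝ) - 1) / 2) * SparseGrid.empiricalNorm x f +
            (n : ℝ)⁻¹ * Real.log n ^ (2 * ((d : ℝ) - 1)) * T.norm f) := by
  obtain ⟨C, hC, bound⟩ := mainTheorem9_general d hd T hT.h1Embedded
  refine ⟨C, hC, fun n hn x hx => ?_⟩
  obtain ⟨τ, hτ, card_gt, hsub⟩ := hx.exists_sparseGrid_subset_range
  exact bound n hn τ hτ card_gt x hsub
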